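/- Let $K$ be an algebraically closed field of characteristic zero (for instance $K=\mathbb{C}$), let $n\ge 3$, and let $a,b,c\in K[s,v]$ be homogeneous polynomials of degree $n$ with $\gcd(a,b,c)=1$ such that the map $\phi:\mathbb{P}^1_K\to\mathbb{P}^2_K$, $(s:v)\mapsto(a(s,v):b(s,v):c(s,v))$, is birational onto its image, the plane curve $\mathcal{C}$. For a point $Q$ of $\mathbb{P}^2_K$ let $m_Q(\mathcal{C})$ be the multiplicity of $\mathcal{C}$ at $Q$, that is, the order of vanishing at $Q$ of an irreducible homogeneous equation of $\mathcal{C}$; a proper singular point of $\mathcal{C}$ is a point $Q\in\mathcal{C}$ with $m_Q(\mathcal{C})>1$ (as opposed to an infinitely near one). Let $p=(p_1,p_2,p_3)$ and $q=(q_1,q_2,q_3)$ be a $\mu$-basis of $\phi$: a basis of the $K[s,v]$-module of syzygies $\{(g_1,g_2,g_3): g_1a+g_2b+g_3c=0\}$ with $p$ homogeneous of degree $\mu$, $q$ homogeneous of degree $n-\mu$, and $\mu\le n-\mu$. For $Q=(\alpha_1:\alpha_2:\alpha_3)$ let $H_Q$ be a greatest common divisor in $K[s,v]$ of $\sum_i\alpha_ip_i(s,v)$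 and $\sum_i\alpha_iq_i(s,v)$; write $H_Q(t,u)$ for it in the variables $t,u$. Put $$p_\phi(s,v;t,u)=p_1(s,v)a(t,u)+p_2(s,v)b(t,u)+p_3(s,v)c(t,u),\qquad q_\phi(s,v;t,u)=q_1(s,v)a(t,u)+q_2(s,v)b(t,u)+q_3(s,v)c(t,u),$$ and let $S_{p_\phi,q_\phi}(t,u)$ be their Sylvester matrix with respect to $(s,v)$, i.e. the $n\times n$ matrix over $K[t,u]$, in the monomial bases, of the map $(\alpha,\beta)\mapsto\alpha p_\phi+\beta q_\phi$, where $\alpha$ and $\beta$ range over the forms in $(s,v)$ with coefficients in $K[t,u]$ of degrees $n-\mu-1$ and $\mu-1$ respectively. Let $d_1,\dots,d_n\in K[t,u]$ be a collection of singular factors of $\phi$: homogeneous polynomials such that for every $i=1,\dots,n$ the product $$d_n^{\,n-i+1}d_{n-1}^{\,n-i}\cdots d_{i+1}^{\,2}d_i$$ is, up to a nonzero constant, the greatest common divisor of the $(n+1-i)$-minors of $S_{p_\phi,q_\phi}(t,u)$. Then for every proper singular point $Q$ of $\mathcal{C}$: $\deg H_Q=m_Q(\mathcal{C})\le n$; the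 polynomial $H_Q(t,u)$ divides $d_{m_Q(\mathcal{C})}(t,u)$; and $H_Q(t,u)$ and $d_k(t,u)$ are coprime (have no nonconstant common factor) for every $k$ with $m_Q(\mathcal{C})<k\le n$. -/

import Mathlib

open MvPolynomial

noncomputable section

namespace RationalCurve

/-- `d` is a greatest common divisor of the elements of `S` (unique up to units). -/
def IsGCDOf {R : Type*} [CommRing R] (S : Set R) (d : R) : Prop :=
  (∀ x ∈ S, d ∣ x) ∧ ∀ e, (∀ x ∈ S, e ∣ x) → e ∣ d

variable {K : Type*} [Field K]

/-- The map `φ : ℙ¹ → ℙ²` given by `f = (a, b, c)` is birational onto its image: there is a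
rational map `(g 0 : g 1) : ℙ² ⇢ ℙ¹`, given by forms of one degree which do not both vanish
identically on the image of `φ`, such that `(g 0 (φ) : g 1 (φ)) = (s : v)`. -/
def IsBirationalOntoImage (f : Fin 3 → MvPolynomial (Fin 2) K) : Prop :=
  ∃ (e : ℕ) (g : Fin 2 → MvPolynomial (Fin 3) K),
    (∀ j, (g j).IsHomogeneous e) ∧
    (∃ j, aeval f (g j) ≠ 0) ∧
    aeval f (g 0) * X 1 = aeval f (g 1) * X 0

/-- Three forms of degree `n` in `K[s, v]` (with `s = X 0`, `v = X 1`), without common factor,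
parameterizing a plane curve birationally onto its image. -/
structure IsProperParametrization (n : ℕ) (f : Fin 3 → MvPolynomial (Fin 2) K) : Prop where
  homogeneous : ∀ i, (f i).IsHomogeneous n
  gcd_eq_one : IsGCDOf (Set.range f) 1
  birational : IsBirationalOntoImage f

/-- The image of `φ : ℙ¹ → ℙ²`, `(s : v) ↦ (a(s, v) : b(s, v) : c(s, v))`. -/
def curve (f : Fin 3 → MvPolynomial (Fin 2) K) : Set (Projectivization K (Fin 3 → K)) :=
  {Q | ∃ x : Fin 2 → K, x ≠ 0 ∧ ∃ h : (fun i => eval x (f i)) ≠ 0, Q = Projectivization.mk K _ h}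

/-- The zero locus in `ℙ²` of a form `F` in three variables. -/
def zeroLocus (F : MvPolynomial (Fin 3) K) : Set (Projectivization K (Fin 3 → K)) :=
  {Q | eval Q.rep F = 0}

/-- The order of vanishing of `F ≠ 0` at `x`: the lowest degree of a nonzero homogeneous component
of `F(x + X)`. For a form `F` and a nonzero vector `x` it only depends on the point of `ℙ²` that
`x` represents, and is the order at that point of any dehomogenization of `F`. -/
def orderAt (F : MvPolynomial (Fin 3) K) (x : Fin 3 → K) : ℕ :=
  sInf {m | homogeneousComponent m (aeval (fun i => X i + C (x i)) F : MvPolynomial (Fin 3) K) ≠ 0}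

/-- The multiplicity at `Q` of an irreducible plane curve `Z`: the order of vanishing at `Q` of an
irreducible form whose zero locus is `Z`. (Over an algebraically closed field such a form is unique
up to a nonzero constant, so that the set below has one element.) -/
def multiplicity (Z : Set (Projectivization K (Fin 3 → K))) (Q : Projectivization K (Fin 3 → K)) :
    ℕ :=
  sInf {m | ∃ (d : ℕ) (F : MvPolynomial (Fin 3) K),
    F.IsHomogeneous d ∧ Irreducible F ∧ zeroLocus F = Z ∧ orderAt F Q.rep = m}

/-- `Q` is a proper (that is, not infinitely near) singular point of `Z`. -/
def IsProperSingularPoint (Z : Set (Projectivization K (Fin 3 → K)))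
    (Q : Projectivization K (Fin 3 → K)) : Prop :=
  Q ∈ Z ∧ 1 < multiplicity Z Q

/-- The module of syzygies of `f = (a, b, c)`: the triples `g` with `∑ gᵢ fᵢ = 0`. -/
def syzygies (f : Fin 3 → MvPolynomial (Fin 2) K) :
    Submodule (MvPolynomial (Fin 2) K) (Fin 3 → MvPolynomial (Fin 2) K) where
  carrier := {g | ∑ i, g i * f i = 0}
  add_mem' := by
    intro g h hg hh
    simp only [Set.mem_ofPred_eq] at hg hh ⊢
    simp [add_mul, Finset.sum_add_distrib, hg, hh]
  zero_mem' := by simp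
  smul_mem' := by
    intro r g hg
    simp only [Set.mem_ofPred_eq] at hg ⊢
    simp [mul_assoc, ← Finset.mul_sum, hg]

/-- `{p, q}` is a `μ`-basis of the parameterization `f` of degree `n`: a basis of the syzygy module
that consists of homogeneous syzygies of degrees `μ ≤ n - μ`. -/
structure IsMuBasis (n μ : ℕ) (f p q : Fin 3 → MvPolynomial (Fin 2) K) : Prop where
  le : μ ≤ n - μ
  homogeneous_p : ∀ i, (p i).IsHomogeneous μ
  homogeneous_q : ∀ i, (q i).IsHomogeneous (n - μ)
  linearIndependent : LinearIndependent (MvPolynomial (Fin 2) K) ![p, q]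
  span_eq : Submodule.span (MvPolynomial (Fin 2) K) {p, q} = syzygies f

/-- `H` is a greatest common divisor of `∑ αᵢ pᵢ` and `∑ αᵢ qᵢ`, for `Q = (α₀ : α₁ : α₂)`. -/
def IsHPoly (p q : Fin 3 → MvPolynomial (Fin 2) K) (Q : Projectivization K (Fin 3 → K))
    (H : MvPolynomial (Fin 2) K) : Prop :=
  IsGCDOf {∑ i, C (Q.rep i) * p i, ∑ i, C (Q.rep i) * q i} H

/-- The form `p_φ(s, v; t, u) = ∑ pᵢ(s, v) fᵢ(t, u)`, as a polynomial in `s, v` with coefficients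
in `K[t, u]`. -/
def substituted (p f : Fin 3 → MvPolynomial (Fin 2) K) :
    MvPolynomial (Fin 2) (MvPolynomial (Fin 2) K) :=
  ∑ i, map C (p i) * C (f i)

/-- The exponent of the monomial `s ^ i * v ^ (d - i)`. -/
def expo (d i : ℕ) : Fin 2 →₀ ℕ :=
  Finsupp.single 0 i + Finsupp.single 1 (d - i)

/-- The Sylvester matrix of `p_φ, q_φ`, over `K[t, u]`: the matrix of `(α, β) ↦ α p_φ + β q_φ`,
for `α`, `β` homogeneous in `(s, v)` of degrees `n - μ - 1`, `μ - 1`, in the monomial bases. -/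
def sylvester (n μ : ℕ) (f p q : Fin 3 → MvPolynomial (Fin 2) K) :
    Matrix (Fin n) (Fin (n - μ) ⊕ Fin μ) (MvPolynomial (Fin 2) K) :=
  Matrix.of fun i => Sum.elim
    (fun j => coeff (expo (n - 1) i) (monomial (expo (n - μ - 1) j) 1 * substituted p f))
    (fun j => coeff (expo (n - 1) i) (monomial (expo (μ - 1) j) 1 * substituted q f))

/-- The `k`-minors of a matrix (each with both signs). -/
def minors {ι κ R : Type*} [CommRing R] (A : Matrix ι κ R) (k : ℕ) : Set R :=
  {x | ∃ (r : Fin k ↪ ι) (c : Fin k ↪ κ), x = (A.submatrix r c).det}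

/-- `d 1, …, d n` is a collection of singular factors: these are forms in `K[t, u]`, and for
`i = 1, …, n` the product `d n ^ (n - i + 1) * ⋯ * d (i + 1) ^ 2 * d i` is the greatest common
divisor of the `(n + 1 - i)`-minors of the Sylvester matrix. -/
def IsSingularFactors (n μ : ℕ) (f p q : Fin 3 → MvPolynomial (Fin 2) K)
    (d : ℕ → MvPolynomial (Fin 2) K) : Prop :=
  (∀ i ∈ Finset.Icc 1 n, ∃ e, (d i).IsHomogeneous e) ∧
  ∀ i ∈ Finset.Icc 1 n,
    IsGCDOf (minors (sylvester n μ f p q) (n + 1 - i)) (∏ k ∈ Finset.Icc i n, d k ^ (k - i + 1))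

end RationalCurve

end

open MvPolynomial

noncomputable section

namespace RationalCurve

/-! Let `x` represent `Q` and let `m = deg H`. Koszul syzygies are combinations of `p` and `q`, and
the `f i` have no common factor; hence `H` is also the gcd of the forms `x i * f j - x j * f i`
(`dvd_koszul`, `dvd_sum_of_dvd_koszul`).

Divisibility. Choose `k` with `x k ≠ 0` and put `l = f k / x k`, which is coprime to `H`. Modulo `H`
one has `f i ≡ l * x i`, so the Sylvester matrix of `p_φ, q_φ` is congruent to `l` times the
constant Sylvester matrix of `∑ x i * p i` and `∑ x i * q i`. The latter has rank `n - m`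
(`rank_formSylvester`). So `H` divides every minor of size `n - m + 1`. If `m < n`, no prime factor
of `H` divides all minors of size `n - m`, so `H` is coprime to `d j` for `m < j ≤ n`. Cancelling
these factors from the gcd of the minors of size `n - m + 1` leaves `H ∣ d m`
(`dvd_singularFactor`).

Multiplicity. Let `F` be an irreducible equation of degree `D`. Move `Q` to `(0:0:1)`; then `H`
becomes the gcd of the first two coordinates of the parametrization, and the order of `F` at `Q` is
`D - deg_z F`. With `r = f 0 / f 1` and `w = f 2 / f 1`, birationality gives `K(r, w) = K(t)`, so
`deg_z F = [K(t) : K(r)] = n - deg H` (`degreeOf_add_totalDegree_gcd`). Thus `ord_Q F + n = D + deg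
H` at every point (`orderAt_add_eq`). A point off the curve yields `D = n`, and then `ord_Q F = deg
H`. -/

theorem aeval_mul_of_isHomogeneous {σ R A : Type*} [CommRing R] [CommRing A] [Algebra R A]
    {P : MvPolynomial σ R} {d : ℕ} (hP : P.IsHomogeneous d) (c : A) (u : σ → A) :
    aeval (fun i => c * u i) P = c ^ d * aeval u P := by
  simp only [aeval_def, eval₂_eq, Finset.mul_sum]
  refine Finset.sum_congr rfl fun s hs => ?_
  rw [← hP (mem_support_iff.mp hs), Finsupp.weight_apply]
  simp only [mul_pow, Finset.prod_mul_distrib, Finset.prod_pow_eq_pow_sum, Finsupp.sum]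
  simp only [Pi.one_apply, smul_eq_mul, mul_one]
  ring

/-! ### Homogeneous components and divisors of forms. -/

section Grading

variable {σ R : Type*} [CommRing R]

/-- The substitution `X i ↦ X i * T`, which separates the homogeneous components. -/
def gradeHom : MvPolynomial σ R →ₐ[R] Polynomial (MvPolynomial σ R) :=
  aeval fun i => Polynomial.C (X i) * Polynomial.X

theorem gradeHom_monomial (s : σ →₀ ℕ) (r : R) :
    gradeHom (monomial s r) = Polynomial.C (monomial s r) * Polynomial.X ^ s.degree := by
  rw [gradeHom, aeval_monomial, monomial_eq]
  simp only [mul_pow, Finsupp.prod, Finset.prod_mul_distrib, Finset.prod_pow_eq_pow_sum,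
    map_mul, map_prod, map_pow, Finsupp.degree]
  rw [mul_assoc]
  rfl

theorem coeff_gradeHom (P : MvPolynomial σ R) (k : ℕ) :
    (gradeHom P).coeff k = homogeneousComponent k P := by
  induction P using MvPolynomial.induction_on' with
  | monomial s r =>
    rw [gradeHom_monomial, Polynomial.coeff_C_mul, Polynomial.coeff_X_pow]
    rw [homogeneousComponent_of_mem (isHomogeneous_monomial r rfl)]
    simp
  | add p q hp hq => simp [hp, hq]

theorem gradeHom_of_isHomogeneous {P : MvPolynomial σ R} {n : ℕ} (hP : P.IsHomogeneous n) :
    gradeHom P = Polynomial.C P * Polynomial.X ^ n := by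
  ext1 k
  rw [coeff_gradeHom, homogeneousComponent_of_mem hP, Polynomial.coeff_C_mul,
    Polynomial.coeff_X_pow]
  simp

theorem gradeHom_injective : Function.Injective (gradeHom (σ := σ) (R := R)) := by
  rw [injective_iff_map_eq_zero]
  intro P hP
  rw [← sum_homogeneousComponent P]
  refine Finset.sum_eq_zero fun i _ => ?_
  rw [← coeff_gradeHom, hP, Polynomial.coeff_zero]

/-- `gradeHom` turns a form into a monomial in `T`. Degree and trailing degree in `T` are both
additive, so a factor of such a monomial has equal degree and trailing degree. -/
theorem isHomogeneous_of_dvd [IsDomain R] {P A : MvPolynomial σ R} {n : ℕ}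
    (hP : P.IsHomogeneous n) (hP0 : P ≠ 0) (h : A ∣ P) : A.IsHomogeneous A.totalDegree := by
  obtain ⟨B, rfl⟩ := h
  have hA0 : A ≠ 0 := left_ne_zero_of_mul hP0
  have hB0 : B ≠ 0 := right_ne_zero_of_mul hP0
  have e := gradeHom_of_isHomogeneous hP
  rw [map_mul] at e
  have gA : gradeHom A ≠ 0 := by rwa [Ne, map_eq_zero_iff _ gradeHom_injective]
  have gB : gradeHom B ≠ 0 := by rwa [Ne, map_eq_zero_iff _ gradeHom_injective]
  have h1 := Polynomial.natDegree_mul gA gB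
  have h2 := Polynomial.natTrailingDegree_mul gA gB
  rw [e, Polynomial.natDegree_C_mul_X_pow _ _ hP0] at h1
  rw [e, Polynomial.C_mul_X_pow_eq_monomial, Polynomial.natTrailingDegree_monomial hP0] at h2
  have h3 := (gradeHom A).natTrailingDegree_le_natDegree
  have h4 := (gradeHom B).natTrailingDegree_le_natDegree
  have key : A.IsHomogeneous (gradeHom A).natDegree := by
    have : A = homogeneousComponent (gradeHom A).natDegree A := by
      conv_lhs => rw [← sum_homogeneousComponent A]
      have hz : ∀ i, i ≠ (gradeHom A).natDegree → homogeneousComponent i A = 0 := by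
        intro i hi
        rw [← coeff_gradeHom]
        rcases lt_or_gt_of_ne hi with h | h
        · exact Polynomial.coeff_eq_zero_of_lt_natTrailingDegree (by omega)
        · exact Polynomial.coeff_eq_zero_of_natDegree_lt h
      by_cases hd : (gradeHom A).natDegree ∈ Finset.range (A.totalDegree + 1)
      · exact Finset.sum_eq_single_of_mem _ hd fun i _ hi => hz i hi
      · rw [Finset.sum_eq_zero fun i hi => hz i (by rintro rfl; exact hd hi)]
        rw [homogeneousComponent_eq_zero]
        simpa using hd
    have hh := homogeneousComponent_isHomogeneous (gradeHom A).natDegree A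
    rwa [← this] at hh
  rwa [key.totalDegree hA0]

theorem isHomogeneous_of_mul_left [IsDomain R] {A B : MvPolynomial σ R} {m n : ℕ}
    (hA : A.IsHomogeneous m) (hA0 : A ≠ 0) (hAB : (A * B).IsHomogeneous (m + n)) :
    B.IsHomogeneous n := by
  by_cases hB0 : B = 0
  · exact hB0 ▸ isHomogeneous_zero σ R n
  have hB := isHomogeneous_of_dvd hAB (mul_ne_zero hA0 hB0) (Dvd.intro_left A rfl)
  have := (hA.mul hB).inj_right hAB (mul_ne_zero hA0 hB0)
  rwa [Nat.add_left_cancel this] at hB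

theorem isUnit_of_isHomogeneous_zero {K : Type*} [Field K] {P : MvPolynomial σ K}
    (h : P.IsHomogeneous 0) (h0 : P ≠ 0) : IsUnit P := by
  have := h.totalDegree h0
  rw [totalDegree_eq_zero_iff_eq_C] at this
  rw [this]
  refine IsUnit.map C (isUnit_iff_ne_zero.mpr fun h => h0 ?_)
  rw [this, h, map_zero]

theorem totalDegree_eq_zero_of_isUnit {K : Type*} [Field K] {P : MvPolynomial σ K}
    (h : IsUnit P) : P.totalDegree = 0 := by
  obtain ⟨Q, hQ⟩ := h.exists_right_inv
  have hP : P ≠ 0 := h.ne_zero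
  have hQ0 : Q ≠ 0 := by rintro rfl; simp at hQ
  have := totalDegree_mul_of_isDomain hP hQ0
  rw [hQ, totalDegree_one] at this
  omega

end Grading

/-! ### Zeros of binary forms. -/

section Binary

variable {K : Type*} [Field K]

/-- Modulo the linear form, `x i * X j ≡ X i * x j` for all `j`; by homogeneity `x i ^ d * a ≡ X i ^
d * a(x) = 0`. -/
theorem linear_dvd_of_eval_eq_zero {a : MvPolynomial (Fin 2) K} {d : ℕ} (ha : a.IsHomogeneous d)
    {x : Fin 2 → K} (hx : x ≠ 0) (h : eval x a = 0) :
    (C (x 1) * X 0 - C (x 0) * X 1 : MvPolynomial (Fin 2) K) ∣ a := by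
  obtain ⟨i, hi⟩ := Function.ne_iff.mp hx
  simp only [Pi.zero_apply] at hi
  set l : MvPolynomial (Fin 2) K := C (x 1) * X 0 - C (x 0) * X 1
  have hl : ∀ j, l ∣ C (x i) * X j - C (x j) * X i := by
    intro j
    fin_cases i <;> fin_cases j <;> simp [l]
    exact (dvd_sub_comm).mp dvd_rfl
  have h1 : (Ideal.Quotient.mkₐ K (Ideal.span {l})) (aeval (fun j => C (x i) * X j) a) =
      (Ideal.Quotient.mkₐ K (Ideal.span {l})) (aeval (fun j => X i * C (x j)) a) := by
    rw [← AlgHom.comp_apply, ← AlgHom.comp_apply, comp_aeval, comp_aeval]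
    congr 2
    funext j
    rw [Ideal.Quotient.mkₐ_eq_mk, Ideal.Quotient.eq, Ideal.mem_span_singleton, mul_comm (X i)]
    exact hl j
  rw [aeval_mul_of_isHomogeneous ha, aeval_mul_of_isHomogeneous ha, aeval_X_left_apply] at h1
  have h2 : aeval (fun j => (C (x j) : MvPolynomial (Fin 2) K)) a = 0 := by
    have : aeval (fun j => (C (x j) : MvPolynomial (Fin 2) K)) a = C (eval x a) := by
      rw [← coe_aeval_eq_eval, ← algebraMap_eq]
      exact (aeval_algebraMap_apply _ _ _)
    rw [this, h, map_zero]
  rw [h2, mul_zero, map_zero, Ideal.Quotient.mkₐ_eq_mk, Ideal.Quotient.eq_zero_iff_mem,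
    Ideal.mem_span_singleton, ← map_pow] at h1
  have hu : IsUnit (C (x i ^ d) : MvPolynomial (Fin 2) K) :=
    (isUnit_iff_ne_zero.mpr (pow_ne_zero _ hi)).map C
  exact (hu.dvd_mul_left).mp h1

theorem eval_ne_zero_of_isRelPrime {a b : MvPolynomial (Fin 2) K} {d e : ℕ}
    (ha : a.IsHomogeneous d) (hb : b.IsHomogeneous e) (hab : IsRelPrime a b)
    {x : Fin 2 → K} (hx : x ≠ 0) : ¬ (eval x a = 0 ∧ eval x b = 0) := by
  rintro ⟨h1, h2⟩
  have h3 := hab (linear_dvd_of_eval_eq_zero ha hx h1) (linear_dvd_of_eval_eq_zero hb hx h2)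
  have h4 := h3.map (eval x)
  simp [mul_comm] at h4

end Binary

/-! ### Rank of a matrix over a field and its minors. -/

section Minors

open Matrix Module

variable {m n K : Type*} [Fintype n] [Field K]

theorem det_submatrix_eq_zero_of_rank_lt (A : Matrix m n K) {k : ℕ} (hk : A.rank < k)
    (r : Fin k → m) (c : Fin k → n) : (A.submatrix r c).det = 0 := by
  by_contra h
  have h1 := rank_of_isUnit (A.submatrix r c)
    ((isUnit_iff_isUnit_det _).mpr (isUnit_iff_ne_zero.mpr h))
  have h2 := rank_submatrix_le A r c
  rw [h1, Fintype.card_fin] at h2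
  omega

theorem exists_linearIndependent_cols (A : Matrix m n K) {k : ℕ} (hk : A.rank = k) :
    ∃ c : Fin k → n, LinearIndependent K (fun j => A.col (c j)) := by
  have := Module.Finite.span_of_finite K (Set.finite_range A.col)
  obtain ⟨v, hv, -, hli⟩ := Submodule.exists_fun_fin_finrank_span_eq K (Set.range A.col)
  rw [rank_eq_finrank_span_cols] at hk
  choose c hc using hv
  subst hk
  exact ⟨c, by simpa only [hc] using hli⟩

theorem exists_det_submatrix_ne_zero [Fintype m] (A : Matrix m n K) {k : ℕ}
    (hk : A.rank = k) : ∃ (r : Fin k ↪ m) (c : Fin k ↪ n), (A.submatrix r c).det ≠ 0 := by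
  obtain ⟨c, hc⟩ := exists_linearIndependent_cols A hk
  set B := (A.submatrix id c)ᵀ with hB
  have hBr : B.rank = k := by
    have : LinearIndependent K B.row := hc
    rw [this.rank_matrix, Fintype.card_fin]
  obtain ⟨r, hr⟩ := exists_linearIndependent_cols B hBr
  have hdet : (A.submatrix r c)ᵀ.det ≠ 0 := by
    rw [← isUnit_iff_ne_zero, ← isUnit_iff_isUnit_det, ← linearIndependent_cols_iff_isUnit]
    exact hr
  rw [det_transpose] at hdet
  refine ⟨⟨r, fun i j h => ?_⟩, ⟨c, fun i j h => ?_⟩, hdet⟩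
  · exact hr.injective (by simp only [h])
  · exact hc.injective (by simp only [h])

end Minors

/-! ### Binary forms as coefficient vectors. -/

section Forms

variable {K : Type*} [Field K]

theorem expo_injective (d : ℕ) : Function.Injective (expo d) := by
  intro i j h
  simpa [expo] using DFunLike.congr_fun h 0

theorem degree_expo {d i : ℕ} (h : i ≤ d) : (expo d i).degree = d := by
  rw [expo, map_add, Finsupp.degree_single, Finsupp.degree_single]
  omega

theorem eq_expo {s : Fin 2 →₀ ℕ} {d : ℕ} (h : s.degree = d) : s = expo d (s 0) := by
  rw [Finsupp.degree_eq_sum, Fin.sum_univ_two] at h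
  ext i
  fin_cases i
  · simp [expo]
  · simp [expo]; omega

variable (K) in
/-- The binary form of degree `k - 1` with given coefficients. -/
def form (k : ℕ) : (Fin k → K) →ₗ[K] MvPolynomial (Fin 2) K :=
  ∑ j : Fin k, (monomial (expo (k - 1) j)) ∘ₗ LinearMap.proj j

theorem form_apply (k : ℕ) (c : Fin k → K) :
    form K k c = ∑ j : Fin k, monomial (expo (k - 1) j) (c j) := by
  simp [form, LinearMap.sum_apply]

theorem coeff_form (k : ℕ) (c : Fin k → K) (j : Fin k) :
    coeff (expo (k - 1) j) (form K k c) = c j := by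
  classical
  simp only [form_apply, coeff_sum, coeff_monomial, (expo_injective (k - 1)).eq_iff]
  simp [Fin.val_inj]

/-- "Form of degree `k - 1`" is expressed as "`X 0 * P` is homogeneous of degree `k`". For `k = 0`
this forces `P = 0`, matching the empty coefficient vector, whereas truncated subtraction would
allow constants. -/
theorem isHomogeneous_X_mul_form (k : ℕ) (c : Fin k → K) :
    (X 0 * form K k c).IsHomogeneous k := by
  rw [form_apply, Finset.mul_sum]
  refine IsHomogeneous.sum _ _ _ fun j _ => ?_
  have h : 1 + (k - 1) = k := by have := j.2; omega
  have := (isHomogeneous_X K (0 : Fin 2)).mul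
    (isHomogeneous_monomial (c j) (degree_expo (d := k - 1) (i := j) (by omega)))
  rwa [h] at this

variable (K) in
/-- The coefficients of a binary form of degree `k - 1`. -/
def formCoeff (k : ℕ) : MvPolynomial (Fin 2) K →ₗ[K] (Fin k → K) :=
  LinearMap.pi fun j => lcoeff K (expo (k - 1) j)

theorem formCoeff_apply (k : ℕ) (P : MvPolynomial (Fin 2) K) (j : Fin k) :
    formCoeff K k P j = coeff (expo (k - 1) j) P := rfl

theorem formCoeff_form (k : ℕ) (c : Fin k → K) : formCoeff K k (form K k c) = c := by
  funext j
  rw [formCoeff_apply, coeff_form]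

theorem eq_zero_of_formCoeff_eq_zero {k : ℕ} {P : MvPolynomial (Fin 2) K}
    (hP : (X 0 * P).IsHomogeneous k) (h : formCoeff K k P = 0) : P = 0 := by
  ext s
  rw [coeff_zero]
  by_contra hs
  have h1 : coeff (Finsupp.single 0 1 + s) (X 0 * P) ≠ 0 := by rwa [coeff_X_mul]
  have h2 : (Finsupp.single (0 : Fin 2) 1 + s).degree = k := by
    by_contra h'
    exact h1 (hP.coeff_eq_zero h')
  rw [map_add, Finsupp.degree_single] at h2
  have h3 : s.degree = k - 1 := by omega
  have h4 : s 0 ≤ s.degree := Finsupp.le_degree 0 s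
  have h5 := congrFun h ⟨s 0, by omega⟩
  rw [formCoeff_apply] at h5
  rw [eq_expo h3] at hs
  exact hs h5

theorem form_formCoeff {k : ℕ} {P : MvPolynomial (Fin 2) K}
    (hP : (X 0 * P).IsHomogeneous k) : form K k (formCoeff K k P) = P := by
  rw [← sub_eq_zero]
  refine eq_zero_of_formCoeff_eq_zero (k := k) ?_ ?_
  · rw [mul_sub]
    exact (isHomogeneous_X_mul_form _ _).sub hP
  · rw [map_sub, formCoeff_form, sub_self]

end Forms

/-! ### The corank of a Sylvester matrix is the degree of the gcd. -/

section SylvesterRank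

variable {K : Type*} [Field K]

/-- The Sylvester matrix of two binary forms of degrees `μ` and `ν` with `n = ν + μ`. -/
def formSylvester (n ν μ : ℕ) (A B : MvPolynomial (Fin 2) K) :
    Matrix (Fin n) (Fin ν ⊕ Fin μ) K :=
  Matrix.of fun i => Sum.elim
    (fun j => coeff (expo (n - 1) i) (monomial (expo (ν - 1) j) 1 * A))
    (fun j => coeff (expo (n - 1) i) (monomial (expo (μ - 1) j) 1 * B))

theorem formSylvester_mulVec (n ν μ : ℕ) (A B : MvPolynomial (Fin 2) K)
    (c : Fin ν ⊕ Fin μ → K) :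
    (formSylvester n ν μ A B).mulVec c =
      formCoeff K n (form K ν (c ∘ Sum.inl) * A + form K μ (c ∘ Sum.inr) * B) := by
  have key : ∀ (e e' : Fin 2 →₀ ℕ) (a : K) (P : MvPolynomial (Fin 2) K),
      coeff e (monomial e' 1 * P) * a = coeff e (monomial e' a * P) := by
    intro e e' a P
    rw [coeff_monomial_mul', coeff_monomial_mul']
    split_ifs <;> ring
  funext i
  simp only [Matrix.mulVec, dotProduct, formSylvester, Matrix.of_apply, Fintype.sum_sum_type,
    Sum.elim_inl, Sum.elim_inr, formCoeff_apply, form_apply, coeff_add, Finset.sum_mul, coeff_sum,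
    key, Function.comp_apply]

theorem exists_eq_mul_of_mul_add_mul_eq_zero {R : Type*} [CommRing R] [IsDomain R]
    [DecompositionMonoid R] {A B a b : R} (hAB : IsRelPrime A B) (h0 : A ≠ 0 ∨ B ≠ 0)
    (h : a * A + b * B = 0) : ∃ c, a = c * B ∧ b = -(c * A) := by
  by_cases hB : B = 0
  · have hA : A ≠ 0 := by tauto
    subst hB
    have hu : IsUnit A := hAB dvd_rfl (dvd_zero _)
    obtain ⟨u, hu⟩ := hu.exists_left_inv
    have ha : a = 0 := by simpa [hA] using h
    exact ⟨-(b * u), by simp [ha], by linear_combination (-b) * hu⟩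
  · have h1 : B ∣ a * A := ⟨-b, by linear_combination h⟩
    obtain ⟨c, rfl⟩ := hAB.symm.dvd_of_dvd_mul_right h1
    refine ⟨c, mul_comm _ _, ?_⟩
    have : B * (b + c * A) = 0 := by linear_combination h
    have := (mul_eq_zero.mp this).resolve_left hB
    linear_combination this

/-- The kernel consists of the pairs `(g * B', -(g * A'))` with `g` of degree `m - 1`, because `A'`
and `B'` are coprime. The map `Φ` parametrizes it by the `m` coefficients of `g`. -/
theorem rank_formSylvester {ν μ m : ℕ} {A' B' H : MvPolynomial (Fin 2) K}
    (hA : (H * A').IsHomogeneous μ) (hB : (H * B').IsHomogeneous ν) (hH : H.IsHomogeneous m)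
    (hH0 : H ≠ 0) (hrel : IsRelPrime A' B') (h0 : A' ≠ 0 ∨ B' ≠ 0) :
    (formSylvester (ν + μ) ν μ (H * A') (H * B')).rank + m = ν + μ := by
  have deg : ∀ {P : MvPolynomial (Fin 2) K} {d : ℕ}, (H * P).IsHomogeneous d → P ≠ 0 →
      ∃ e, d = m + e ∧ P.IsHomogeneous e := by
    intro P d hP hP0
    have h1 := isHomogeneous_of_dvd hP (mul_ne_zero hH0 hP0) (Dvd.intro_left H rfl)
    exact ⟨_, hP.inj_right (hH.mul h1) (mul_ne_zero hH0 hP0), h1⟩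
  have deg' : ∀ {P : MvPolynomial (Fin 2) K} {d : ℕ} (c : MvPolynomial (Fin 2) K),
      (H * P).IsHomogeneous d → (X 0 * c).IsHomogeneous m → (X 0 * (c * P)).IsHomogeneous d := by
    intro P d c hP hc
    by_cases hP0 : P = 0
    · simpa [hP0] using isHomogeneous_zero (Fin 2) K d
    · obtain ⟨e, rfl, he⟩ := deg hP hP0
      rw [← mul_assoc]
      exact hc.mul he
  set M := formSylvester (ν + μ) ν μ (H * A') (H * B')
  let Φ : (Fin m → K) →ₗ[K] (Fin ν ⊕ Fin μ → K) :=
    { toFun := fun c => Sum.elim (formCoeff K ν (form K m c * B'))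
        (formCoeff K μ (-(form K m c * A')))
      map_add' := by
        intro c c'
        rw [map_add, add_mul, add_mul, neg_add, map_add, map_add]
        funext i
        cases i <;> simp
      map_smul' := by
        intro r c
        rw [map_smul, smul_mul_assoc, smul_mul_assoc, ← smul_neg, map_smul, map_smul]
        funext i
        cases i <;> simp }
  have hΦl : ∀ c, form K ν (Φ c ∘ Sum.inl) = form K m c * B' := fun c =>
    form_formCoeff (deg' _ hB (isHomogeneous_X_mul_form m c))
  have hΦr : ∀ c, form K μ (Φ c ∘ Sum.inr) = -(form K m c * A') := fun c =>
    form_formCoeff (by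
      rw [mul_neg]
      exact (deg' _ hA (isHomogeneous_X_mul_form m c)).neg)
  have hinj : Function.Injective Φ := by
    rw [injective_iff_map_eq_zero]
    intro c hc
    have h1 := hΦl c
    have h2 := hΦr c
    rw [hc] at h1 h2
    have e1 : form K m c * B' = 0 := by rw [← h1]; exact map_zero _
    have e2 : form K m c * A' = 0 := by rw [← neg_eq_zero, ← h2]; exact map_zero _
    have e3 : form K m c = 0 := by
      rcases h0 with h | h
      · exact (mul_eq_zero.mp e2).resolve_right h
      · exact (mul_eq_zero.mp e1).resolve_right h
    rw [← formCoeff_form m c, e3, map_zero]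
  have hrange : LinearMap.range Φ = LinearMap.ker M.mulVecLin := by
    ext c
    rw [LinearMap.mem_range, LinearMap.mem_ker, Matrix.mulVecLin_apply, formSylvester_mulVec]
    constructor
    · rintro ⟨g, rfl⟩
      rw [hΦl, hΦr]
      convert map_zero (formCoeff K (ν + μ))
      ring
    · intro h
      have h1 := eq_zero_of_formCoeff_eq_zero ?_ h
      · have h2 : form K ν (c ∘ Sum.inl) * A' + form K μ (c ∘ Sum.inr) * B' = 0 := by
          have : H * (form K ν (c ∘ Sum.inl) * A' + form K μ (c ∘ Sum.inr) * B') = 0 := by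
            linear_combination h1
          exact (mul_eq_zero.mp this).resolve_left hH0
        obtain ⟨g, hg1, hg2⟩ := exists_eq_mul_of_mul_add_mul_eq_zero hrel h0 h2
        have hl := isHomogeneous_X_mul_form ν (c ∘ Sum.inl)
        have hr := (isHomogeneous_X_mul_form μ (c ∘ Sum.inr)).neg
        rw [hg1] at hl
        rw [hg2, mul_neg, neg_neg] at hr
        -- The degree of `g` is read off by dividing by whichever of `A'`, `B'` is nonzero.
        have hg : (X 0 * g).IsHomogeneous m := by
          rcases h0 with h' | h'
          · obtain ⟨e, he, h3⟩ := deg hA h'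
            refine isHomogeneous_of_mul_left (m := e) h3 h' ?_
            rw [add_comm e, ← he, show A' * (X 0 * g) = X 0 * (g * A') by ring]
            exact hr
          · obtain ⟨e, he, h3⟩ := deg hB h'
            refine isHomogeneous_of_mul_left (m := e) h3 h' ?_
            rw [add_comm e, ← he, show B' * (X 0 * g) = X 0 * (g * B') by ring]
            exact hl
        refine ⟨formCoeff K m g, ?_⟩
        funext i
        rcases i with i | i
        · change formCoeff K ν (form K m (formCoeff K m g) * B') i = _
          rw [form_formCoeff hg, ← hg1, formCoeff_form]
          rfl
        · change formCoeff K μ (-(form K m (formCoeff K m g) * A')) i = _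
          rw [form_formCoeff hg, ← hg2, formCoeff_form]
          rfl
      · rw [mul_add, ← mul_assoc (X 0) _ (H * A'), ← mul_assoc (X 0) _ (H * B')]
        refine IsHomogeneous.add ((isHomogeneous_X_mul_form _ _).mul hA) ?_
        rw [add_comm ν]
        exact (isHomogeneous_X_mul_form _ _).mul hB
  have h1 := LinearMap.finrank_range_add_finrank_ker M.mulVecLin
  rw [← hrange, LinearMap.finrank_range_of_inj hinj] at h1
  simpa [Matrix.rank] using h1

end SylvesterRank

theorem IsGCDOf.isRelPrime_of_eq_mul {R : Type*} [CommRing R] [IsDomain R] {a b d a' b' : R}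
    (h : IsGCDOf {a, b} d) (hd : d ≠ 0) (ha : a = d * a') (hb : b = d * b') :
    IsRelPrime a' b' := by
  intro e hea heb
  have h1 : d * e ∣ d * 1 := by
    rw [mul_one]
    refine h.2 _ fun x hx => ?_
    rcases hx with rfl | rfl
    · rw [ha]; exact mul_dvd_mul_left d hea
    · rw [hb]; exact mul_dvd_mul_left d heb
  exact isUnit_of_dvd_one ((mul_dvd_mul_iff_left hd).mp h1)

theorem isRelPrime_of_forall_prime {R : Type*} [CommRing R] [IsDomain R]
    [UniqueFactorizationMonoid R] {a b : R} (ha : a ≠ 0)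
    (h : ∀ g, Prime g → g ∣ a → ¬ g ∣ b) : IsRelPrime a b := by
  refine isRelPrime_of_no_nonunits_factors (fun h0 => ha h0.1) fun z hz hz0 hza hzb => ?_
  obtain ⟨g, hg, hgz⟩ := WfDvdMonoid.exists_irreducible_factor hz hz0
  exact h g hg.prime (hgz.trans hza) (hgz.trans hzb)

/-! ### The polynomial `H` as the gcd of the forms `x i * f j - x j * f i`. -/

section Syzygies

variable {K : Type*} [Field K] {n : ℕ} {f p q : Fin 3 → MvPolynomial (Fin 2) K}

/-- The Koszul syzygy with entries `f j` and `-f i` in positions `i` and `j` is a combination of `p`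
and `q`; pairing it with `x` gives the claim. -/
theorem dvd_koszul (hspan : Submodule.span (MvPolynomial (Fin 2) K) {p, q} = syzygies f)
    {x : Fin 3 → K} {H : MvPolynomial (Fin 2) K} (hp : H ∣ ∑ i, C (x i) * p i)
    (hq : H ∣ ∑ i, C (x i) * q i) (i j : Fin 3) :
    H ∣ C (x i) * f j - C (x j) * f i := by
  have hmem : (Pi.single i (f j) - Pi.single j (f i) : Fin 3 → MvPolynomial (Fin 2) K) ∈
      syzygies f := by
    change ∑ k, _ = _
    simp only [Pi.sub_apply, Pi.single_apply, sub_mul, Finset.sum_sub_distrib, ite_mul, zero_mul,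
      Finset.sum_ite_eq', Finset.mem_univ, if_true]
    ring
  rw [← hspan, Submodule.mem_span_pair] at hmem
  obtain ⟨a, b, hab⟩ := hmem
  have h1 : C (x i) * f j - C (x j) * f i =
      a * ∑ k, C (x k) * p k + b * ∑ k, C (x k) * q k := by
    have h2 : ∑ k, C (x k) * (a • p + b • q) k = C (x i) * f j - C (x j) * f i := by
      rw [hab]
      simp [mul_sub, Finset.sum_sub_distrib, Pi.single_apply]
    rw [← h2, Finset.mul_sum, Finset.mul_sum, ← Finset.sum_add_distrib]
    refine Finset.sum_congr rfl fun k _ => ?_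
    simp only [Pi.add_apply, Pi.smul_apply, smul_eq_mul]
    ring
  rw [h1]
  exact dvd_add (hp.mul_left a) (hq.mul_left b)

/-- A common factor of `D` and `f k` divides `x k * f j` for every `j`, hence divides all the `f j`.
-/
theorem isRelPrime_of_dvd_koszul (hgcd : IsGCDOf (Set.range f) 1) {x : Fin 3 → K} {k : Fin 3}
    (hk : x k ≠ 0) {D : MvPolynomial (Fin 2) K}
    (hD : ∀ i j, D ∣ C (x i) * f j - C (x j) * f i) : IsRelPrime D (f k) := by
  intro e heD hek
  refine isUnit_of_dvd_one (hgcd.2 e ?_)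
  rintro _ ⟨j, rfl⟩
  have hu : IsUnit (C (x k) : MvPolynomial (Fin 2) K) := (isUnit_iff_ne_zero.mpr hk).map C
  rw [← hu.dvd_mul_left]
  have := dvd_add (heD.trans (hD k j)) (hek.mul_left (C (x j)))
  simpa using this

/-- Modulo `D`, `f k * ∑ x i * p i ≡ x k * ∑ p i * f i = 0`, and `f k` is coprime to `D`. -/
theorem dvd_sum_of_dvd_koszul (hgcd : IsGCDOf (Set.range f) 1) {x : Fin 3 → K} (hx : x ≠ 0)
    {D : MvPolynomial (Fin 2) K} (hD : ∀ i j, D ∣ C (x i) * f j - C (x j) * f i)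
    (hp : ∑ i, p i * f i = 0) : D ∣ ∑ i, C (x i) * p i := by
  obtain ⟨k, hk⟩ := Function.ne_iff.mp hx
  refine (isRelPrime_of_dvd_koszul hgcd hk hD).dvd_of_dvd_mul_left (z := ∑ i, C (x i) * p i) ?_
  have h1 : f k * ∑ i, C (x i) * p i = ∑ i, p i * (C (x i) * f k - C (x k) * f i) := by
    have : C (x k) * ∑ i, p i * f i = 0 := by rw [hp, mul_zero]
    rw [Finset.mul_sum] at this ⊢
    rw [← sub_zero (∑ i, f k * _), ← this, ← Finset.sum_sub_distrib]
    exact Finset.sum_congr rfl fun i _ => by ring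
  rw [h1]
  exact Finset.dvd_sum fun i _ => (hD i k).mul_left _

theorem exists_koszul_ne_zero (hn : 0 < n) (hf : ∀ i, (f i).IsHomogeneous n)
    (hgcd : IsGCDOf (Set.range f) 1) {x : Fin 3 → K} (hx : x ≠ 0) :
    ∃ i j, C (x i) * f j - C (x j) * f i ≠ 0 := by
  by_contra! h
  obtain ⟨k, hk⟩ := Function.ne_iff.mp hx
  -- If all these forms vanish, `D = 0` is admissible; being coprime to `0` makes `f k` a unit,
  -- against `n > 0`.
  have h1 := isRelPrime_of_dvd_koszul hgcd hk (D := 0) fun i j => by rw [h i j]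
  have hu : IsUnit (f k) := h1 (dvd_zero _) dvd_rfl
  have h2 := totalDegree_eq_zero_of_isUnit hu
  rw [(hf k).totalDegree hu.ne_zero] at h2
  omega

end Syzygies

/-! ### Minors of the Sylvester matrix modulo `H`. -/

section SingularFactors

variable {K : Type*} [Field K] {n μ : ℕ} {f p q : Fin 3 → MvPolynomial (Fin 2) K}

theorem isHomogeneous_sum_C_mul {d : ℕ} (hp : ∀ i, (p i).IsHomogeneous d) (x : Fin 3 → K) :
    (∑ i, C (x i) * p i).IsHomogeneous d :=
  IsHomogeneous.sum _ _ _ fun i _ => (hp i).C_mul (x i)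

/-- Modulo `H`, `f i ≡ (f k / x k) * x i`, so `p_φ` is congruent to `f k / x k` times the form `∑ x
i * p i` with constant coefficients. -/
theorem dvd_coeff_substituted_sub {x : Fin 3 → K} {k : Fin 3} (hk : x k ≠ 0)
    {H : MvPolynomial (Fin 2) K} (hH : ∀ i j, H ∣ C (x i) * f j - C (x j) * f i)
    (e e' : Fin 2 →₀ ℕ) :
    H ∣ coeff e (monomial e' 1 * substituted p f) -
      C (x k)⁻¹ * f k * C (coeff e (monomial e' 1 * ∑ i, C (x i) * p i)) := by
  have hs : ∀ (s : Fin 2 →₀ ℕ) (i : Fin 3),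
      coeff s (map C (p i) * C (f i)) = C (coeff s (p i)) * f i := fun s i => by
    rw [mul_comm, coeff_C_mul, coeff_map, mul_comm]
  rw [coeff_monomial_mul', coeff_monomial_mul']
  split_ifs
  · simp only [substituted, coeff_sum, hs, coeff_C_mul, one_mul, map_sum,
      map_mul, Finset.mul_sum]
    rw [← Finset.sum_sub_distrib]
    refine Finset.dvd_sum fun i _ => ?_
    have h1 : (C (x k)⁻¹ * C (x k) : MvPolynomial (Fin 2) K) = 1 := by
      rw [← map_mul, inv_mul_cancel₀ hk, map_one]
    have h2 : C (coeff (e - e') (p i)) * f i -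
        C (x k)⁻¹ * f k * (C (x i) * C (coeff (e - e') (p i))) =
        C (coeff (e - e') (p i)) * C (x k)⁻¹ * (C (x k) * f i - C (x i) * f k) := by
      linear_combination (-(C (coeff (e - e') (p i)) * f i)) * h1
    rw [h2]
    exact (hH k i).mul_left _
  · simp

theorem dvd_minor_sub {x : Fin 3 → K} {k : Fin 3} (hk : x k ≠ 0)
    {H : MvPolynomial (Fin 2) K} (hH : ∀ i j, H ∣ C (x i) * f j - C (x j) * f i)
    {N : ℕ} (r : Fin N → Fin n) (c : Fin N → Fin (n - μ) ⊕ Fin μ) :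
    H ∣ ((sylvester n μ f p q).submatrix r c).det - (C (x k)⁻¹ * f k) ^ N *
      C (((formSylvester n (n - μ) μ (∑ i, C (x i) * p i) (∑ i, C (x i) * q i)).submatrix
        r c).det) := by
  set M := formSylvester n (n - μ) μ (∑ i, C (x i) * p i) (∑ i, C (x i) * q i)
  set l := C (x k)⁻¹ * f k
  have h1 : ((sylvester n μ f p q).submatrix r c).map (Ideal.Quotient.mk (Ideal.span {H})) =
      (l • ((M.submatrix r c).map C)).map (Ideal.Quotient.mk (Ideal.span {H})) := by
    ext i j
    rw [Matrix.map_apply, Matrix.map_apply, Ideal.Quotient.eq, Ideal.mem_span_singleton,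
      Matrix.smul_apply, Matrix.map_apply, smul_eq_mul, Matrix.submatrix_apply,
      Matrix.submatrix_apply]
    rcases c j with j | j
    · exact dvd_coeff_substituted_sub hk hH _ _
    · exact dvd_coeff_substituted_sub hk hH _ _
  have h2 : (l • ((M.submatrix r c).map C)).det = l ^ N * C ((M.submatrix r c).det) := by
    rw [Matrix.det_smul, Fintype.card_fin, RingHom.map_det]
    rfl
  rw [← h2, ← Ideal.mem_span_singleton, ← Ideal.Quotient.eq, RingHom.map_det, RingHom.map_det]
  exact congrArg Matrix.det h1

theorem IsMuBasis.mu_le (h : IsMuBasis n μ f p q) : μ ≤ n := h.le.trans (Nat.sub_le _ _)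

theorem exists_isHPoly_eq_mul (hn : 0 < n) (hf : IsProperParametrization n f)
    (hpq : IsMuBasis n μ f p q) {x : Fin 3 → K} (hx : x ≠ 0) {H : MvPolynomial (Fin 2) K}
    (hH : IsGCDOf {∑ i, C (x i) * p i, ∑ i, C (x i) * q i} H) :
    H ≠ 0 ∧ H.IsHomogeneous H.totalDegree ∧ H.totalDegree ≤ n ∧
    (∀ i j, H ∣ C (x i) * f j - C (x j) * f i) ∧
    (formSylvester n (n - μ) μ (∑ i, C (x i) * p i) (∑ i, C (x i) * q i)).rank +
      H.totalDegree = n := by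
  have hA := isHomogeneous_sum_C_mul hpq.homogeneous_p x
  have hB := isHomogeneous_sum_C_mul hpq.homogeneous_q x
  have hHA := hH.1 _ (Set.mem_insert _ _)
  have hHB := hH.1 _ (Set.mem_insert_of_mem _ rfl)
  have hK := dvd_koszul hpq.span_eq hHA hHB
  have hAB : ¬ (∑ i, C (x i) * p i = 0 ∧ ∑ i, C (x i) * q i = 0) := by
    rintro ⟨h1, h2⟩
    obtain ⟨i, j, hij⟩ := exists_koszul_ne_zero hn hf.homogeneous hf.gcd_eq_one hx
    exact hij (zero_dvd_iff.mp (dvd_koszul hpq.span_eq (h1 ▸ dvd_rfl) (h2 ▸ dvd_rfl) i j))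
  have hH0 : H ≠ 0 := by
    rintro rfl
    exact hAB ⟨zero_dvd_iff.mp hHA, zero_dvd_iff.mp hHB⟩
  have hHh : H.IsHomogeneous H.totalDegree := by
    by_cases h : ∑ i, C (x i) * p i = 0
    · exact isHomogeneous_of_dvd hB (fun h' => hAB ⟨h, h'⟩) hHB
    · exact isHomogeneous_of_dvd hA h hHA
  obtain ⟨A', hA'⟩ := hHA
  obtain ⟨B', hB'⟩ := hHB
  have hrel := hH.isRelPrime_of_eq_mul hH0 hA' hB'
  have h0 : A' ≠ 0 ∨ B' ≠ 0 := by
    by_contra! h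
    exact hAB ⟨by rw [hA', h.1, mul_zero], by rw [hB', h.2, mul_zero]⟩
  rw [hA'] at hA
  rw [hB'] at hB
  have hr := rank_formSylvester hA hB hHh hH0 hrel h0
  rw [Nat.sub_add_cancel hpq.mu_le] at hr
  rw [hA', hB']
  exact ⟨hH0, hHh, by omega, hK, hr⟩

theorem dvd_singularFactor (hn : 0 < n) (hf : IsProperParametrization n f)
    (hpq : IsMuBasis n μ f p q) {d : ℕ → MvPolynomial (Fin 2) K}
    (hd : IsSingularFactors n μ f p q d) {x : Fin 3 → K} (hx : x ≠ 0)
    {H : MvPolynomial (Fin 2) K}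
    (hH : IsGCDOf {∑ i, C (x i) * p i, ∑ i, C (x i) * q i} H) (hm : 0 < H.totalDegree) :
    H ∣ d H.totalDegree ∧ ∀ k, H.totalDegree < k → k ≤ n → IsRelPrime H (d k) := by
  obtain ⟨hH0, -, hle, hK, hr⟩ := exists_isHPoly_eq_mul hn hf hpq hx hH
  obtain ⟨k, hk⟩ := Function.ne_iff.mp hx
  set M := formSylvester n (n - μ) μ (∑ i, C (x i) * p i) (∑ i, C (x i) * q i) with hM
  set m := H.totalDegree
  have hcop : ∀ j, m < j → j ≤ n → IsRelPrime H (d j) := by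
    intro j hj hjn
    refine isRelPrime_of_forall_prime hH0 ?_
    intro g hg hgH hgd
    -- The size `n + 1 - (m + 1) = n - m` is the rank of `M`, and the gcd of the minors of this size
    -- contains `d j` for every `j` with `m < j ≤ n`.
    obtain ⟨r, c, hrc⟩ := exists_det_submatrix_ne_zero M (k := n + 1 - (m + 1)) (by omega)
    have hprod : g ∣ ∏ k ∈ Finset.Icc (m + 1) n, d k ^ (k - (m + 1) + 1) :=
      (hgd.trans (dvd_pow_self _ (by omega))).trans
        (Finset.dvd_prod_of_mem _ (Finset.mem_Icc.mpr ⟨hj, hjn⟩))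
    have h1 := hprod.trans ((hd.2 (m + 1) (Finset.mem_Icc.mpr ⟨by omega, by omega⟩)).1 _
      ⟨r, c, rfl⟩)
    have h2 := hgH.trans (dvd_minor_sub (p := p) (q := q) hk hK r c)
    rw [← hM] at h2
    -- A prime `g` dividing `H` and `d j` would divide a nonzero constant times a power of `f k / x
    -- k`, hence `f k`, which is coprime to `H`.
    have h3 := (dvd_sub_right h1).mp h2
    have hu : IsUnit (C (M.submatrix r c).det : MvPolynomial (Fin 2) K) :=
      (isUnit_iff_ne_zero.mpr hrc).map C
    rw [hu.dvd_mul_right] at h3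
    have h4 := hg.dvd_of_dvd_pow h3
    have hu' : IsUnit (C (x k)⁻¹ : MvPolynomial (Fin 2) K) :=
      (isUnit_iff_ne_zero.mpr (inv_ne_zero hk)).map C
    rw [hu'.dvd_mul_left] at h4
    exact hg.not_isUnit (isRelPrime_of_dvd_koszul hf.gcd_eq_one hk hK hgH h4)
  refine ⟨?_, hcop⟩
  -- Minors of size `n + 1 - m` exceed the rank of `M`, so they vanish for `M` and are divisible by
  -- `H` for the Sylvester matrix.
  have h1 : H ∣ ∏ k ∈ Finset.Icc m n, d k ^ (k - m + 1) := by
    refine (hd.2 m (Finset.mem_Icc.mpr ⟨hm, hle⟩)).2 H ?_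
    rintro _ ⟨r, c, rfl⟩
    have h2 := dvd_minor_sub (p := p) (q := q) hk hK r c
    rw [← hM, det_submatrix_eq_zero_of_rank_lt M (by omega), map_zero, mul_zero, sub_zero] at h2
    exact h2
  rw [← Finset.insert_Icc_add_one_left_eq_Icc hle, Finset.prod_insert (by simp), Nat.sub_self,
    zero_add, pow_one] at h1
  refine IsRelPrime.dvd_of_dvd_mul_right ?_ h1
  refine IsRelPrime.prod_right fun j hj => ?_
  rw [Finset.mem_Icc] at hj
  exact (hcop j hj.1 hj.2).pow_right

end SingularFactors

/-! ### Binary forms and the degree of a rational function. -/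

section Dehomogenize

variable {K : Type*} [Field K]

variable (K) in
/-- Dehomogenization `s ↦ t, v ↦ 1` of binary forms. -/
def dehom : MvPolynomial (Fin 2) K →ₐ[K] Polynomial K := aeval ![Polynomial.X, 1]

theorem dehom_eq_sum (a : MvPolynomial (Fin 2) K) :
    dehom K a = ∑ s ∈ a.support, Polynomial.monomial (s 0) (coeff s a) := by
  rw [dehom, aeval_def, eval₂_eq']
  refine Finset.sum_congr rfl fun s _ => ?_
  simp [Fin.prod_univ_two, ← Polynomial.C_mul_X_pow_eq_monomial]

theorem eval_dehom (a : MvPolynomial (Fin 2) K) (z : K) :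
    (dehom K a).eval z = eval ![z, 1] a := by
  have h : ((Polynomial.aeval z).comp (dehom K)) = aeval ![z, 1] := by
    ext i
    fin_cases i <;> simp [dehom]
  have h' := DFunLike.congr_fun h a
  simpa [coe_aeval_eq_eval, Polynomial.aeval_def] using h'

theorem natDegree_dehom_le {a : MvPolynomial (Fin 2) K} {d : ℕ} (ha : a.IsHomogeneous d) :
    (dehom K a).natDegree ≤ d := by
  rw [dehom_eq_sum]
  refine Polynomial.natDegree_sum_le_of_forall_le _ _ fun s hs => ?_
  refine (Polynomial.natDegree_monomial_le _).trans ?_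
  have h1 := ha.degree_eq_sum_deg_support hs
  have h2 : s 0 ≤ s.degree := Finsupp.le_degree 0 s
  rw [Finsupp.degree_apply] at h2
  omega

theorem coeff_dehom {a : MvPolynomial (Fin 2) K} {d : ℕ} (ha : a.IsHomogeneous d) :
    (dehom K a).coeff d = eval ![1, 0] a := by
  rw [dehom_eq_sum, eval_eq', Polynomial.finsetSum_coeff]
  refine Finset.sum_congr rfl fun s hs => ?_
  have h1 : s.degree = d := by
    by_contra h
    exact (mem_support_iff.mp hs) (ha.coeff_eq_zero h)
  rw [Finsupp.degree_eq_sum, Fin.sum_univ_two] at h1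
  rw [Polynomial.coeff_monomial, Fin.prod_univ_two]
  by_cases h : s 0 = d
  · have : s 1 = 0 := by omega
    simp [h, this]
  · have : s 1 ≠ 0 := by omega
    simp [h, this]

theorem dehom_ne_zero {a : MvPolynomial (Fin 2) K} {d : ℕ} (ha : a.IsHomogeneous d)
    (h0 : a ≠ 0) : dehom K a ≠ 0 := by
  intro h
  obtain ⟨s, hs⟩ := ne_zero_iff.mp h0
  have hdeg : ∀ t ∈ a.support, t.degree = d := fun t ht => by
    by_contra h
    exact (mem_support_iff.mp ht) (ha.coeff_eq_zero h)
  have h1 : (dehom K a).coeff (s 0) = coeff s a := by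
    rw [dehom_eq_sum, Polynomial.finsetSum_coeff,
      Finset.sum_eq_single_of_mem s (mem_support_iff.mpr hs)]
    · simp
    · intro t ht hts
      rw [Polynomial.coeff_monomial, if_neg]
      intro h0
      apply hts
      rw [eq_expo (hdeg t ht), eq_expo (hdeg s (mem_support_iff.mpr hs)), h0]
  rw [h, Polynomial.coeff_zero] at h1
  exact hs h1.symm

variable (K) in
/-- Dehomogenization of binary forms, with values in the field of rational functions. -/
def ratDehom : MvPolynomial (Fin 2) K →ₐ[K] RatFunc K :=
  (Algebra.algHom K (Polynomial K) (RatFunc K)).comp (dehom K)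

theorem ratDehom_apply (a : MvPolynomial (Fin 2) K) :
    ratDehom K a = algebraMap (Polynomial K) (RatFunc K) (dehom K a) := rfl

theorem ratDehom_ne_zero {a : MvPolynomial (Fin 2) K} {d : ℕ} (ha : a.IsHomogeneous d)
    (h0 : a ≠ 0) : ratDehom K a ≠ 0 := by
  rw [ratDehom_apply]
  exact RatFunc.algebraMap_ne_zero (dehom_ne_zero ha h0)

theorem max_natDegree_div {A B : Polynomial K} (hAB : IsCoprime A B) (hB : B ≠ 0) :
    max (algebraMap _ (RatFunc K) A / algebraMap _ (RatFunc K) B).num.natDegree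
      (algebraMap _ (RatFunc K) A / algebraMap _ (RatFunc K) B).denom.natDegree =
      max A.natDegree B.natDegree := by
  set r := algebraMap _ (RatFunc K) A / algebraMap _ (RatFunc K) B with hr
  have hB' : algebraMap _ (RatFunc K) B ≠ 0 := RatFunc.algebraMap_ne_zero hB
  have hd' : algebraMap _ (RatFunc K) r.denom ≠ 0 := RatFunc.algebraMap_ne_zero r.denom_ne_zero
  have h1 : r.num * B = A * r.denom := by
    apply RatFunc.algebraMap_injective
    rw [map_mul, map_mul, ← div_eq_div_iff hd' hB', RatFunc.num_div_denom]
  have hc := r.isCoprime_num_denom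
  have e1 : Associated B r.denom := associated_of_dvd_dvd
    (hAB.symm.dvd_of_dvd_mul_left ⟨r.num, by rw [← h1, mul_comm]⟩)
    (hc.symm.dvd_of_dvd_mul_left ⟨A, by rw [h1, mul_comm]⟩)
  have e2 : Associated A r.num := associated_of_dvd_dvd
    (hAB.dvd_of_dvd_mul_right ⟨r.denom, h1⟩)
    (hc.dvd_of_dvd_mul_right ⟨B, h1.symm⟩)
  rw [Polynomial.natDegree_eq_of_degree_eq (Polynomial.degree_eq_degree_of_associated e1),
    Polynomial.natDegree_eq_of_degree_eq (Polynomial.degree_eq_degree_of_associated e2)]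

/-- Dehomogenizing lowers the degree only of a form vanishing at `(1:0)`; coprime forms do not both
vanish there, nor at any `(z:1)`, so the quotient is reduced and of full degree. -/
theorem max_natDegree_ratDehom [IsAlgClosed K] {a b : MvPolynomial (Fin 2) K} {d : ℕ}
    (ha : a.IsHomogeneous d) (hb : b.IsHomogeneous d) (hab : IsRelPrime a b) (hb0 : b ≠ 0) :
    max (ratDehom K a / ratDehom K b).num.natDegree
      (ratDehom K a / ratDehom K b).denom.natDegree = d := by
  rw [ratDehom_apply, ratDehom_apply, max_natDegree_div _ (dehom_ne_zero hb hb0)]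
  · refine le_antisymm (max_le (natDegree_dehom_le ha) (natDegree_dehom_le hb)) ?_
    by_contra! h
    rw [max_lt_iff] at h
    refine eval_ne_zero_of_isRelPrime ha hb hab (x := ![1, 0]) (by simp) ⟨?_, ?_⟩
    · rw [← coeff_dehom ha, Polynomial.coeff_eq_zero_of_natDegree_lt h.1]
    · rw [← coeff_dehom hb, Polynomial.coeff_eq_zero_of_natDegree_lt h.2]
  · rw [Polynomial.isCoprime_iff_aeval_ne_zero_of_isAlgClosed K K]
    intro z
    by_contra! h
    simp only [Polynomial.coe_aeval_eq_eval, eval_dehom] at h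
    exact eval_ne_zero_of_isRelPrime ha hb hab (x := ![z, 1]) (by simp) h

end Dehomogenize

/-! ### Dehomogenization of ternary forms, preserving primality. -/

section Affine

variable {K : Type*} [Field K]

variable (K) in
/-- The dehomogenization `x ↦ X, y ↦ 1, z ↦ Z` with values in `K[X][Z]`. -/
def affine : MvPolynomial (Fin 3) K →ₐ[K] Polynomial (Polynomial K) :=
  aeval ![Polynomial.C Polynomial.X, 1, Polynomial.X]

theorem affine_eq_sum (F : MvPolynomial (Fin 3) K) : affine K F =
    ∑ s ∈ F.support, Polynomial.monomial (s 2) (Polynomial.monomial (s 0) (coeff s F)) := by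
  rw [affine, aeval_def, eval₂_eq']
  refine Finset.sum_congr rfl fun s _ => ?_
  simp only [Fin.prod_univ_three, ← Polynomial.C_mul_X_pow_eq_monomial]
  simp [IsScalarTower.algebraMap_apply K (Polynomial K) (Polynomial (Polynomial K)), mul_assoc]

theorem coeff_coeff_affine {F : MvPolynomial (Fin 3) K} {D : ℕ} (hF : F.IsHomogeneous D)
    {s : Fin 3 →₀ ℕ} (hs : s.degree = D) :
    ((affine K F).coeff (s 2)).coeff (s 0) = coeff s F := by
  have hdeg : ∀ t ∈ F.support, t.degree = D := fun t ht => by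
    by_contra h
    exact (mem_support_iff.mp ht) (hF.coeff_eq_zero h)
  rw [affine_eq_sum, Polynomial.finsetSum_coeff, Polynomial.finsetSum_coeff]
  rw [Finset.sum_eq_single s]
  · simp
  · intro t ht hts
    rw [Polynomial.coeff_monomial]
    split_ifs with h2
    · rw [Polynomial.coeff_monomial, if_neg]
      intro h0
      apply hts
      have h1 := hdeg t ht
      rw [Finsupp.degree_eq_sum, Fin.sum_univ_three] at h1 hs
      ext i
      fin_cases i
      · exact h0
      · simp only [Fin.mk_one]
        omega
      · exact h2
    · simp
  · intro h
    simp [notMem_support_iff.mp h]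

theorem affine_injOn {F G : MvPolynomial (Fin 3) K} {D : ℕ} (hF : F.IsHomogeneous D)
    (hG : G.IsHomogeneous D) (h : affine K F = affine K G) : F = G := by
  ext s
  by_cases hs : s.degree = D
  · rw [← coeff_coeff_affine hF hs, ← coeff_coeff_affine hG hs, h]
  · rw [hF.coeff_eq_zero hs, hG.coeff_eq_zero hs]

theorem natDegree_affine {F : MvPolynomial (Fin 3) K} {D : ℕ} (hF : F.IsHomogeneous D) :
    (affine K F).natDegree = degreeOf 2 F := by
  refine le_antisymm ?_ ?_
  · rw [affine_eq_sum]
    refine Polynomial.natDegree_sum_le_of_forall_le _ _ fun s hs => ?_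
    exact (Polynomial.natDegree_monomial_le _).trans (monomial_le_degreeOf 2 hs)
  · rw [degreeOf_le_iff]
    intro s hs
    by_contra! h
    have hd : s.degree = D := by
      by_contra h
      exact (mem_support_iff.mp hs) (hF.coeff_eq_zero h)
    apply mem_support_iff.mp hs
    rw [← coeff_coeff_affine hF hd, Polynomial.coeff_eq_zero_of_natDegree_lt h,
      Polynomial.coeff_zero]

/-- Every sufficiently large degree is available, so that homogenized identities can be balanced in
degree. -/
theorem exists_isHomogeneous_affine_eq (U : Polynomial (Polynomial K)) :
    ∃ k₀, ∀ k, k₀ ≤ k → ∃ P : MvPolynomial (Fin 3) K, P.IsHomogeneous k ∧ affine K P = U := by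
  induction U using Polynomial.induction_on' with
  | add U V hU hV =>
    obtain ⟨k, hk⟩ := hU
    obtain ⟨l, hl⟩ := hV
    refine ⟨max k l, fun j hj => ?_⟩
    obtain ⟨P, hP, hPU⟩ := hk j (le_of_max_le_left hj)
    obtain ⟨Q, hQ, hQV⟩ := hl j (le_of_max_le_right hj)
    exact ⟨P + Q, hP.add hQ, by rw [map_add, hPU, hQV]⟩
  | monomial b u =>
    induction u using Polynomial.induction_on' with
    | add u v hu hv =>
      obtain ⟨k, hk⟩ := hu
      obtain ⟨l, hl⟩ := hv
      refine ⟨max k l, fun j hj => ?_⟩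
      obtain ⟨P, hP, hPU⟩ := hk j (le_of_max_le_left hj)
      obtain ⟨Q, hQ, hQV⟩ := hl j (le_of_max_le_right hj)
      exact ⟨P + Q, hP.add hQ, by rw [map_add, hPU, hQV, map_add]⟩
    | monomial i c =>
      refine ⟨i + b, fun k hk => ⟨C c * X 0 ^ i * X 1 ^ (k - i - b) * X 2 ^ b, ?_, ?_⟩⟩
      · have := (((isHomogeneous_C (Fin 3) c).mul (isHomogeneous_X_pow (R := K) (0 : Fin 3) i)).mul
          (isHomogeneous_X_pow (R := K) (1 : Fin 3) (k - i - b))).mul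
          (isHomogeneous_X_pow (R := K) (2 : Fin 3) b)
        rwa [show 0 + i + (k - i - b) + b = k by omega] at this
      · simp [affine, ← Polynomial.C_mul_X_pow_eq_monomial,
          IsScalarTower.algebraMap_apply K (Polynomial K) (Polynomial (Polynomial K))]

/-- Relations in `K[X][Z]` lift to relations between forms of equal degree, where `affine` is
injective. A unit would make `F` divide a power of `X 1`. -/
theorem prime_affine {F : MvPolynomial (Fin 3) K} {D : ℕ} (hF : F.IsHomogeneous D)
    (hirr : Irreducible F) (h1 : ¬ F ∣ X 1) : Prime (affine K F) := by
  have hp := hirr.prime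
  have hX : affine K (X 1) = 1 := by simp [affine]
  refine ⟨fun h => hp.ne_zero ?_, fun h => ?_, fun U V hUV => ?_⟩
  · exact affine_injOn hF (isHomogeneous_zero _ _ _) (by rw [h, map_zero])
  · obtain ⟨U, hU⟩ := h.exists_right_inv
    obtain ⟨k, hk⟩ := exists_isHomogeneous_affine_eq U
    obtain ⟨P, hP, rfl⟩ := hk k le_rfl
    have : F * P = X 1 ^ (D + k) := affine_injOn (hF.mul hP) (isHomogeneous_X_pow _ _)
      (by rw [map_mul, hU, map_pow, hX, one_pow])
    exact h1 (hp.dvd_of_dvd_pow (Dvd.intro _ this))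
  · obtain ⟨W, hW⟩ := hUV
    obtain ⟨k, hk⟩ := exists_isHomogeneous_affine_eq U
    obtain ⟨l, hl⟩ := exists_isHomogeneous_affine_eq V
    obtain ⟨j, hj⟩ := exists_isHomogeneous_affine_eq W
    obtain ⟨P, hP, rfl⟩ := hk (k + j + D) (by omega)
    obtain ⟨Q, hQ, rfl⟩ := hl l le_rfl
    obtain ⟨R, hR, rfl⟩ := hj (k + j + l) (by omega)
    have h2 := hF.mul hR
    rw [show D + (k + j + l) = k + j + D + l by omega] at h2
    have : P * Q = F * R := affine_injOn (hP.mul hQ) h2 (by rw [map_mul, hW, map_mul])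
    rcases hp.dvd_or_dvd (Dvd.intro _ this.symm) with h | h
    · exact Or.inl (map_dvd _ h)
    · exact Or.inr (map_dvd _ h)

end Affine

/-! ### The degree of the equation in one variable as a field degree. -/

section FieldDegree

open IntermediateField algebraAdjoinAdjoin

variable {K : Type*} [Field K]

/-- Since `r` is transcendental, `K[r]` is a polynomial ring. By Gauss's lemma `P` stays irreducible
over `K(r)`, so it is the minimal polynomial of `w` up to a scalar. -/
theorem finrank_adjoin_eq_natDegree {r w : RatFunc K} (hr : ¬ ∃ c, r = RatFunc.C c)
    {P : Polynomial (Polynomial K)} (hP : Prime P)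
    (h0 : Polynomial.eval₂ (Polynomial.aeval r : Polynomial K →ₐ[K] RatFunc K).toRingHom w P = 0) :
    Module.finrank K⟮r⟯ K⟮r⟯⟮w⟯ = P.natDegree := by
  have htr := r.transcendental_of_ne_C hr
  have := htr.uniqueFactorizationMonoid_adjoin
  let e := Polynomial.algEquivOfTranscendental K r htr
  have hirr : Irreducible (P.mapEquiv e.toRingEquiv) := by
    rw [MulEquiv.irreducible_iff]
    exact hP.irreducible
  have hdeg : (P.mapEquiv e.toRingEquiv).natDegree = P.natDegree := by
    rw [Polynomial.mapEquiv_apply]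
    exact Polynomial.natDegree_map_eq_of_injective e.injective P
  have hpos : P.natDegree ≠ 0 := by
    intro h
    rw [Polynomial.natDegree_eq_zero] at h
    obtain ⟨u, rfl⟩ := h
    rw [Polynomial.eval₂_C] at h0
    have : u = 0 := (transcendental_iff.mp htr) u h0
    exact hP.ne_zero (by rw [this, map_zero])
  have hprim := hirr.isPrimitive (by rwa [hdeg])
  rw [hprim.irreducible_iff_irreducible_map_fraction_map (K := K⟮r⟯)] at hirr
  have hroot : Polynomial.aeval w
      ((P.mapEquiv e.toRingEquiv).map (algebraMap (Algebra.adjoin K {r}) K⟮r⟯)) = 0 := by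
    rw [Polynomial.mapEquiv_apply, Polynomial.map_map, Polynomial.aeval_def, Polynomial.eval₂_map,
      ← h0]
    congr 1
    refine Polynomial.ringHom_ext (fun c => ?_) ?_
    · have : e (Polynomial.C c) = algebraMap K _ c := e.commutes c
      simp [this]
    · simp [e]
  have halg : IsIntegral K⟮r⟯ w := by
    rw [← isAlgebraic_iff_isIntegral]
    exact ⟨_, hirr.ne_zero, hroot⟩
  rw [adjoin.finrank halg, ← minpoly.eq_of_irreducible hirr hroot, mul_comm,
    Polynomial.natDegree_C_mul (inv_ne_zero (Polynomial.leadingCoeff_ne_zero.mpr hirr.ne_zero)),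
    Polynomial.natDegree_map_eq_of_injective
      (IsFractionRing.injective (Algebra.adjoin K {r}) K⟮r⟯), hdeg]

theorem ratDehom_X_zero : ratDehom K (X 0) = RatFunc.X := by
  simp [ratDehom_apply, dehom]

theorem ratDehom_X_one : ratDehom K (X 1) = 1 := by
  simp [ratDehom_apply, dehom]

theorem isHomogeneous_aeval {f : Fin 3 → MvPolynomial (Fin 2) K} {n d : ℕ}
    (hf : ∀ i, (f i).IsHomogeneous n) {F : MvPolynomial (Fin 3) K} (hF : F.IsHomogeneous d) :
    (aeval f F).IsHomogeneous (n * d) := hF.aeval _ hf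

/-- Scaling the parameterization by the second coordinate. -/
theorem ratDehom_aeval {f : Fin 3 → MvPolynomial (Fin 2) K} (h1 : ratDehom K (f 1) ≠ 0)
    {F : MvPolynomial (Fin 3) K} {d : ℕ} (hF : F.IsHomogeneous d) :
    ratDehom K (aeval f F) = ratDehom K (f 1) ^ d *
      aeval (fun i => ratDehom K (f i) / ratDehom K (f 1)) F := by
  rw [← aeval_mul_of_isHomogeneous hF, ← AlgHom.comp_apply, comp_aeval]
  congr 2
  funext i
  rw [mul_div_cancel₀ _ h1]

/-- The inverse rational map writes the parameter as a quotient of polynomials in the affine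
coordinates of the curve. -/
theorem mem_of_isBirationalOntoImage {f : Fin 3 → MvPolynomial (Fin 2) K} {n : ℕ}
    (hf : ∀ i, (f i).IsHomogeneous n) (h1 : f 1 ≠ 0) (hb : IsBirationalOntoImage f)
    (E : IntermediateField K (RatFunc K))
    (hE : ∀ i, ratDehom K (f i) / ratDehom K (f 1) ∈ E) : RatFunc.X ∈ E := by
  have h1' := ratDehom_ne_zero (hf 1) h1
  obtain ⟨e, g, hg, ⟨j, hj⟩, hX⟩ := hb
  have hg1 : aeval f (g 1) ≠ 0 := by
    intro h
    rw [h, zero_mul] at hX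
    have h0 : aeval f (g 0) = 0 := (mul_eq_zero.mp hX).resolve_right (X_ne_zero 1)
    fin_cases j
    · exact hj h0
    · exact hj h
  have hr1 := ratDehom_ne_zero (isHomogeneous_aeval hf (hg 1)) hg1
  have hX' := congrArg (ratDehom K) hX
  rw [map_mul, map_mul, ratDehom_X_zero, ratDehom_X_one, mul_one] at hX'
  rw [ratDehom_aeval h1' (hg 1)] at hr1 hX'
  rw [ratDehom_aeval h1' (hg 0)] at hX'
  have hmem : ∀ G : MvPolynomial (Fin 3) K,
      aeval (fun i => ratDehom K (f i) / ratDehom K (f 1)) G ∈ E := by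
    intro G
    have : (fun i => ratDehom K (f i) / ratDehom K (f 1)) =
        algebraMap E (RatFunc K) ∘ fun i => ⟨_, hE i⟩ := rfl
    rw [this, aeval_algebraMap_apply]
    exact SetLike.coe_mem _
  have : RatFunc.X = aeval (fun i => ratDehom K (f i) / ratDehom K (f 1)) (g 0) /
      aeval (fun i => ratDehom K (f i) / ratDehom K (f 1)) (g 1) := by
    rw [eq_div_iff (right_ne_zero_of_mul hr1)]
    refine mul_left_cancel₀ (left_ne_zero_of_mul hr1) ?_
    rw [hX']
    ring
  rw [this]
  exact E.div_mem (hmem _) (hmem _)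

theorem isRelPrime_of_associated_of_gcd {f : Fin 3 → MvPolynomial (Fin 2) K}
    (hgcd : IsGCDOf (Set.range f) 1) {G : MvPolynomial (Fin 2) K} (h0 : G ∣ f 0)
    (h1 : f 1 ∣ G) : IsRelPrime (f 2) (f 1) := by
  intro e he2 he1
  refine isUnit_of_dvd_one (hgcd.2 e ?_)
  rintro _ ⟨j, rfl⟩
  fin_cases j
  · exact he1.trans (h1.trans h0)
  · exact he1
  · exact he2

/-- After cancelling `G`, `r` is a reduced fraction of degree `n - deg G`, which equals `[K(t) :
K(r)]`. As `K(r, w) = K(t)`, this is also the degree of `w` over `K(r)`, namely `deg_z F`. -/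
theorem degreeOf_add_totalDegree_gcd [IsAlgClosed K] {f : Fin 3 → MvPolynomial (Fin 2) K} {n D : ℕ}
    (hn : 2 ≤ n) (hf : ∀ i, (f i).IsHomogeneous n) (hgcd : IsGCDOf (Set.range f) 1)
    (hb : IsBirationalOntoImage f) (h1 : f 1 ≠ 0) {G : MvPolynomial (Fin 2) K}
    (hG : IsGCDOf {f 0, f 1} G) {F : MvPolynomial (Fin 3) K} (hF : F.IsHomogeneous D)
    (hirr : Irreducible F) (hFf : aeval f F = 0) :
    degreeOf 2 F + G.totalDegree = n := by
  have h1' := ratDehom_ne_zero (hf 1) h1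
  have hd0 := hG.1 _ (Set.mem_insert _ _)
  have hd1 := hG.1 _ (Set.mem_insert_of_mem _ rfl)
  have hG0 : G ≠ 0 := by
    rintro rfl
    exact h1 (zero_dvd_iff.mp hd1)
  have hGh := isHomogeneous_of_dvd (hf 1) h1 hd1
  obtain ⟨a, ha⟩ := hd0
  obtain ⟨b, hb'⟩ := hd1
  have hb0 : b ≠ 0 := by
    rintro rfl
    exact h1 (by rw [hb', mul_zero])
  have hbh := isHomogeneous_of_dvd (hf 1) h1 (Dvd.intro_left G hb'.symm)
  have hdeg : G.totalDegree + b.totalDegree = n :=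
    (hGh.mul hbh).inj_right (hb' ▸ hf 1) (hb' ▸ h1)
  have hah : a.IsHomogeneous b.totalDegree :=
    isHomogeneous_of_mul_left hGh hG0 (by rw [← ha, hdeg]; exact hf 0)
  have hrel := hG.isRelPrime_of_eq_mul hG0 ha hb'
  set r := ratDehom K (f 0) / ratDehom K (f 1) with hr
  set w := ratDehom K (f 2) / ratDehom K (f 1) with hw
  have hrab : r = ratDehom K a / ratDehom K b := by
    rw [hr, ha, hb', map_mul, map_mul, mul_div_mul_left _ _ (ratDehom_ne_zero hGh hG0)]
  have hfin := r.finrank_eq_max_natDegree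
  have hmax := max_natDegree_ratDehom hah hbh hrel hb0
  rw [← hrab] at hmax
  rw [hmax] at hfin
  have hcoord : (fun i => ratDehom K (f i) / ratDehom K (f 1)) = ![r, 1, w] := by
    funext i
    fin_cases i
    · rfl
    · exact div_self h1'
    · rfl
  have hmem : ∀ E : IntermediateField K (RatFunc K), r ∈ E → w ∈ E → RatFunc.X ∈ E := by
    intro E hrE hwE
    refine mem_of_isBirationalOntoImage hf h1 hb E fun i => ?_
    have : ratDehom K (f i) / ratDehom K (f 1) = ![r, 1, w] i := congrFun hcoord i
    rw [this]
    fin_cases i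
    · exact hrE
    · exact E.one_mem
    · exact hwE
  -- If `r` is constant, `f 1` divides `f 0` and `w` alone generates `K(t)`; but then `w` has degree
  -- `n ≥ 2`, a contradiction.
  by_cases hrC : ∃ c, r = RatFunc.C c
  · exfalso
    have hdb : b.totalDegree = 0 := by
      obtain ⟨c, hc⟩ := hrC
      rw [← hmax, hc]
      simp
    have hub : IsUnit b := isUnit_of_isHomogeneous_zero (hdb ▸ hbh) hb0
    have hrel' := isRelPrime_of_associated_of_gcd hgcd (Dvd.intro a ha.symm)
      (by rw [hb']; exact hub.mul_right_dvd.mpr dvd_rfl)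
    have hmax' := max_natDegree_ratDehom (hf 2) (hf 1) hrel' h1
    rw [← hw, ← w.finrank_eq_max_natDegree] at hmax'
    have htop : K⟮w⟯ = ⊤ := by
      rw [eq_top_iff, ← RatFunc.adjoin_X, adjoin_simple_le_iff]
      refine hmem _ ?_ (mem_adjoin_simple_self K w)
      obtain ⟨c, hc⟩ := hrC
      rw [hc]
      exact K⟮w⟯.algebraMap_mem c
    rw [htop, IntermediateField.finrank_top] at hmax'
    omega
  · have hF1 : ¬ F ∣ X 1 := by
      rintro ⟨P, hP⟩
      have := congrArg (aeval f) hP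
      rw [aeval_X, map_mul, hFf, zero_mul] at this
      exact h1 this
    have hroot : Polynomial.eval₂ (Polynomial.aeval r : Polynomial K →ₐ[K] RatFunc K).toRingHom w
        (affine K F) = 0 := by
      have h2 := ratDehom_aeval h1' hF
      rw [hFf, map_zero, hcoord] at h2
      have h3 := (mul_eq_zero.mp h2.symm).resolve_left (pow_ne_zero _ h1')
      rw [← h3]
      have h4 : ((Polynomial.eval₂RingHom
          (Polynomial.aeval r : Polynomial K →ₐ[K] RatFunc K).toRingHom w).comp
          (affine K).toRingHom) = (aeval ![r, 1, w] : MvPolynomial (Fin 3) K →ₐ[K] _).toRingHom := by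
        refine MvPolynomial.ringHom_ext (fun c => ?_) fun i => ?_
        · simp [IsScalarTower.algebraMap_apply K (Polynomial K) (Polynomial (Polynomial K))]
        · fin_cases i <;> simp [affine]
      exact DFunLike.congr_fun h4 F
    have hkey := finrank_adjoin_eq_natDegree hrC (prime_affine hF hirr hF1) hroot
    rw [natDegree_affine hF] at hkey
    have htop : K⟮r⟯⟮w⟯ = ⊤ := by
      rw [eq_top_iff, ← RatFunc.IntermediateField.adjoin_X K⟮r⟯, adjoin_simple_le_iff]
      refine hmem (K⟮r⟯⟮w⟯.restrictScalars K) ?_ ?_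
      · exact K⟮r⟯⟮w⟯.algebraMap_mem ⟨r, mem_adjoin_simple_self K r⟩
      · exact mem_adjoin_simple_self K⟮r⟯ w
    rw [htop, IntermediateField.finrank_top', hfin] at hkey
    omega

end FieldDegree

/-! ### The order of vanishing at `(0:0:1)`. -/

section Order

variable {K : Type*} [Field K]

theorem orderAt_eq_of_homogeneousComponent {F : MvPolynomial (Fin 3) K} {x : Fin 3 → K} {m : ℕ}
    (h0 : ∀ k < m, homogeneousComponent k
      (aeval (fun i => X i + C (x i)) F : MvPolynomial (Fin 3) K) = 0)
    (h1 : homogeneousComponent m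
      (aeval (fun i => X i + C (x i)) F : MvPolynomial (Fin 3) K) ≠ 0) : orderAt F x = m := by
  refine le_antisymm (Nat.sInf_le h1) (le_csInf ⟨m, h1⟩ fun k hk => ?_)
  by_contra! h
  exact hk (h0 k h)

theorem orderAt_eq_zero {F : MvPolynomial (Fin 3) K} {x : Fin 3 → K} (h : eval x F ≠ 0) :
    orderAt F x = 0 := by
  refine orderAt_eq_of_homogeneousComponent (fun k hk => absurd hk (Nat.not_lt_zero k)) ?_
  have h1 : coeff 0 (aeval (fun i => X i + C (x i)) F : MvPolynomial (Fin 3) K) = eval x F := by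
    rw [← constantCoeff_eq]
    change (constantCoeff.comp (aeval (fun i => X i + C (x i))).toRingHom) F = _
    congr 1
    refine MvPolynomial.ringHom_ext (fun c => ?_) fun i => ?_ <;> simp
  rw [homogeneousComponent_zero, h1]
  simpa using h

theorem gradeHom_shift (F : MvPolynomial (Fin 3) K) :
    gradeHom (aeval (fun i => X i + C ((Pi.single 2 1 : Fin 3 → K) i)) F :
      MvPolynomial (Fin 3) K) =
    ∑ s ∈ F.support, Polynomial.C (monomial (s.erase 2) (coeff s F)) *
      (Polynomial.C (X 2) * Polynomial.X + 1) ^ s 2 * Polynomial.X ^ (s 0 + s 1) := by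
  rw [← AlgHom.comp_apply, comp_aeval, aeval_def, eval₂_eq']
  refine Finset.sum_congr rfl fun s _ => ?_
  have h1 : (monomial (s.erase 2) (coeff s F) : MvPolynomial (Fin 3) K) =
      C (coeff s F) * (X 0 ^ s 0 * X 1 ^ s 1) := by
    rw [monomial_eq, Finsupp.prod_fintype _ _ (by simp), Fin.prod_univ_three]
    simp
  rw [h1]
  simp only [Fin.prod_univ_three, gradeHom]
  simp
  ring

/-- Replacing `z` by `z + 1` turns `x^a y^b z^c` into terms of degree at least `a + b = D - c`, so
the order is attained at the largest exponent of `z`. -/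
theorem orderAt_single_add_degreeOf {F : MvPolynomial (Fin 3) K} {D : ℕ}
    (hF : F.IsHomogeneous D) (hF0 : F ≠ 0) :
    orderAt F (Pi.single 2 1) + degreeOf 2 F = D := by
  have hdeg : ∀ t ∈ F.support, t 0 + t 1 + t 2 = D := fun t ht => by
    rw [← Fin.sum_univ_three, ← Finsupp.degree_eq_sum]
    by_contra h
    exact (mem_support_iff.mp ht) (hF.coeff_eq_zero h)
  obtain ⟨s, hs, hs2⟩ : ∃ s ∈ F.support, degreeOf 2 F = s 2 := by
    rw [degreeOf_eq_sup]
    exact Finset.exists_mem_eq_sup _ (support_nonempty.mpr hF0) _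
  have hle : ∀ t ∈ F.support, t 2 ≤ s 2 := fun t ht => hs2 ▸ monomial_le_degreeOf 2 ht
  have hsD := hdeg s hs
  rw [hs2]
  suffices h : orderAt F (Pi.single 2 1) = s 0 + s 1 by omega
  refine orderAt_eq_of_homogeneousComponent (fun k hk => ?_) fun h0 => ?_
  · rw [← coeff_gradeHom, gradeHom_shift, Polynomial.finsetSum_coeff]
    refine Finset.sum_eq_zero fun t ht => ?_
    have := hdeg t ht
    have := hle t ht
    rw [Polynomial.coeff_mul_X_pow', if_neg (by omega)]
  -- The coefficient free of `z` isolates `s`: monomials of equal total degree and top degree in `z`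
  -- remain distinct once `z` is erased.
  · have h1 := congrArg (coeff (s.erase 2)) h0
    rw [← coeff_gradeHom, gradeHom_shift, Polynomial.finsetSum_coeff, coeff_sum,
      Finset.sum_eq_single_of_mem s hs] at h1
    · rw [Polynomial.coeff_mul_X_pow', if_pos le_rfl, Nat.sub_self, Polynomial.coeff_C_mul] at h1
      simp [Polynomial.coeff_zero_eq_eval_zero] at h1
      exact mem_support_iff.mp hs h1
    · intro t ht hts
      have h2 := hdeg t ht
      have h3 := hle t ht
      rw [Polynomial.coeff_mul_X_pow']
      split_ifs with h4
      · have h5 : t 2 = s 2 := by omega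
        rw [show s 0 + s 1 - (t 0 + t 1) = 0 by omega, Polynomial.coeff_C_mul]
        have h6 : t.erase 2 ≠ s.erase 2 := by
          intro h
          apply hts
          ext i
          by_cases hi : i = 2
          · rw [hi, h5]
          · rw [← Finsupp.erase_ne (f := t) hi, h, Finsupp.erase_ne hi]
        simp [Polynomial.coeff_zero_eq_eval_zero, coeff_monomial, h6]
      · rw [coeff_zero]

end Order

/-! ### Linear changes of coordinates moving `Q` to `(0:0:1)`. -/

section LinearChange

variable {K : Type*} [Field K]

/-- The substitution `F ↦ F (B X)`. -/
def linearSubst (B : Matrix (Fin 3) (Fin 3) K) :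
    MvPolynomial (Fin 3) K →ₐ[K] MvPolynomial (Fin 3) K :=
  aeval fun i => ∑ j, C (B i j) * X j

theorem linearSubst_comp (B B' : Matrix (Fin 3) (Fin 3) K) (h : B' * B = 1) :
    (linearSubst B).comp (linearSubst B') = AlgHom.id K _ := by
  ext1 i
  have : ∀ k, ∑ j, B' i j * B j k = if i = k then 1 else 0 := fun k => by
    rw [← Matrix.mul_apply, h, Matrix.one_apply]
  have h2 : ∀ j, linearSubst B (C (B' i j) * X j) = ∑ k, C (B' i j * B j k) * X k := by
    intro j
    rw [map_mul, ← algebraMap_eq, AlgHom.commutes, linearSubst, aeval_X, Finset.mul_sum]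
    simp only [algebraMap_eq, map_mul, mul_assoc]
  rw [AlgHom.comp_apply, linearSubst.eq_def B', aeval_X, map_sum]
  simp only [h2]
  rw [Finset.sum_comm]
  simp only [← Finset.sum_mul, ← map_sum, this]
  simp

/-- An invertible linear change of coordinates. -/
def linearSubstEquiv {B B' : Matrix (Fin 3) (Fin 3) K} (h : B * B' = 1) (h' : B' * B = 1) :
    MvPolynomial (Fin 3) K ≃ₐ[K] MvPolynomial (Fin 3) K :=
  AlgEquiv.ofAlgHom (linearSubst B) (linearSubst B') (linearSubst_comp B B' h')
    (linearSubst_comp B' B h)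

theorem isHomogeneous_linearSubst (B : Matrix (Fin 3) (Fin 3) K) {F : MvPolynomial (Fin 3) K}
    {d : ℕ} (hF : F.IsHomogeneous d) : (linearSubst B F).IsHomogeneous d := by
  have := hF.aeval (fun i => ∑ j, C (B i j) * X j) (n := 1) fun i =>
    IsHomogeneous.sum _ _ _ fun j _ => isHomogeneous_C_mul_X _ _
  rwa [one_mul] at this

theorem gradeHom_linearSubst (B : Matrix (Fin 3) (Fin 3) K) (F : MvPolynomial (Fin 3) K) :
    gradeHom (linearSubst B F) = (gradeHom F).map (linearSubst B).toRingHom := by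
  have : gradeHom.comp (linearSubst B) = (Polynomial.mapAlgHom (linearSubst B)).comp gradeHom := by
    ext1 i
    rw [AlgHom.comp_apply, AlgHom.comp_apply, gradeHom_of_isHomogeneous
      (isHomogeneous_linearSubst B (isHomogeneous_X K i)),
      gradeHom_of_isHomogeneous (isHomogeneous_X K i)]
    simp
  have h := DFunLike.congr_fun this F
  rwa [AlgHom.comp_apply, AlgHom.comp_apply] at h

/-- An invertible linear substitution carries the translation by `B x` to the translation by `x` and
commutes with taking homogeneous components. -/
theorem orderAt_linearSubst {B B' : Matrix (Fin 3) (Fin 3) K} (h : B * B' = 1) (h' : B' * B = 1)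
    (F : MvPolynomial (Fin 3) K) (x : Fin 3 → K) :
    orderAt (linearSubst B F) x = orderAt F (B.mulVec x) := by
  have h1 : (aeval (fun i => X i + C (x i)) (linearSubst B F) : MvPolynomial (Fin 3) K) =
      linearSubst B (aeval (fun i => X i + C (B.mulVec x i)) F) := by
    have h2 : (aeval fun i => X i + C (x i) :
        MvPolynomial (Fin 3) K →ₐ[K] MvPolynomial (Fin 3) K).comp (linearSubst B) =
        (linearSubst B).comp (aeval fun i => X i + C (B.mulVec x i)) := by
      ext1 i
      simp only [AlgHom.comp_apply, linearSubst, aeval_X, map_sum, map_mul, map_add, Matrix.mulVec,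
        dotProduct]
      simp [mul_add, Finset.sum_add_distrib, algebraMap_eq]
    have h3 := DFunLike.congr_fun h2 F
    rwa [AlgHom.comp_apply, AlgHom.comp_apply] at h3
  unfold orderAt
  congr 1
  ext k
  simp only [Set.mem_ofPred_eq]
  rw [h1, ← coeff_gradeHom, gradeHom_linearSubst, Polynomial.coeff_map, coeff_gradeHom]
  exact map_ne_zero_iff _ (linearSubstEquiv h h').injective

theorem exists_matrix_col_eq {x : Fin 3 → K} (hx : x ≠ 0) :
    ∃ B B' : Matrix (Fin 3) (Fin 3) K, B * B' = 1 ∧ B' * B = 1 ∧ ∀ i, B i 2 = x i := by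
  suffices h : ∃ B : Matrix (Fin 3) (Fin 3) K, B.det ≠ 0 ∧ ∀ i, B i 2 = x i by
    obtain ⟨B, hB, hx⟩ := h
    have hu : IsUnit B.det := isUnit_iff_ne_zero.mpr hB
    exact ⟨B, B⁻¹, Matrix.mul_nonsing_inv _ hu, Matrix.nonsing_inv_mul _ hu, hx⟩
  obtain ⟨k, hk⟩ := Function.ne_iff.mp hx
  simp only [Pi.zero_apply] at hk
  fin_cases k
  · refine ⟨!![0, 0, x 0; 1, 0, x 1; 0, 1, x 2], ?_, fun i => by fin_cases i <;> rfl⟩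
    simpa [Matrix.det_fin_three] using hk
  · refine ⟨!![1, 0, x 0; 0, 0, x 1; 0, 1, x 2], ?_, fun i => by fin_cases i <;> rfl⟩
    simpa [Matrix.det_fin_three] using hk
  · refine ⟨!![1, 0, x 0; 0, 1, x 1; 0, 0, x 2], ?_, fun i => by fin_cases i <;> rfl⟩
    simpa [Matrix.det_fin_three] using hk

/-- The parameterization in the coordinates given by a matrix. -/
def changeParam (B : Matrix (Fin 3) (Fin 3) K) (f : Fin 3 → MvPolynomial (Fin 2) K) :
    Fin 3 → MvPolynomial (Fin 2) K :=
  fun i => ∑ j, C (B i j) * f j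

theorem changeParam_changeParam {B B' : Matrix (Fin 3) (Fin 3) K} (h : B * B' = 1)
    (f : Fin 3 → MvPolynomial (Fin 2) K) : changeParam B (changeParam B' f) = f := by
  funext i
  have : ∀ k, ∑ j, B i j * B' j k = if i = k then 1 else 0 := fun k => by
    rw [← Matrix.mul_apply, h, Matrix.one_apply]
  simp only [changeParam, Finset.mul_sum, ← mul_assoc, ← map_mul]
  rw [Finset.sum_comm]
  simp only [← Finset.sum_mul, ← map_sum, this]
  simp

theorem aeval_linearSubst (B : Matrix (Fin 3) (Fin 3) K) (f : Fin 3 → MvPolynomial (Fin 2) K)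
    (F : MvPolynomial (Fin 3) K) : aeval f (linearSubst B F) = aeval (changeParam B f) F := by
  rw [← AlgHom.comp_apply]
  congr 1
  ext1 i
  simp [linearSubst, changeParam, algebraMap_eq]

theorem dvd_changeParam {B : Matrix (Fin 3) (Fin 3) K} {f : Fin 3 → MvPolynomial (Fin 2) K}
    {e : MvPolynomial (Fin 2) K} (he : ∀ i, e ∣ f i) (i : Fin 3) : e ∣ changeParam B f i :=
  Finset.dvd_sum fun j _ => (he j).mul_left _

theorem isProperParametrization_changeParam {B B' : Matrix (Fin 3) (Fin 3) K} (h : B * B' = 1)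
    {n : ℕ} {f : Fin 3 → MvPolynomial (Fin 2) K} (hf : IsProperParametrization n f) :
    IsProperParametrization n (changeParam B' f) where
  homogeneous i := IsHomogeneous.sum _ _ _ fun j _ => (hf.homogeneous j).C_mul _
  gcd_eq_one := by
    refine ⟨fun _ _ => one_dvd _, fun e he => hf.gcd_eq_one.2 e ?_⟩
    rintro _ ⟨i, rfl⟩
    rw [← changeParam_changeParam h f]
    exact dvd_changeParam (fun j => he _ ⟨j, rfl⟩) i
  birational := by
    obtain ⟨e, g, hg, hne, hX⟩ := hf.birational
    refine ⟨e, fun j => linearSubst B (g j), fun j => isHomogeneous_linearSubst B (hg j), ?_, ?_⟩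
    · simpa only [aeval_linearSubst, changeParam_changeParam h] using hne
    · simpa only [aeval_linearSubst, changeParam_changeParam h] using hX

/-- The rows of `B'` other than the last annihilate `x`, so `x k` times such a new coordinate is a
combination of the forms `x k * f j - x j * f k`. -/
theorem dvd_changeParam_of_dvd_koszul {B B' : Matrix (Fin 3) (Fin 3) K} (h' : B' * B = 1)
    {x : Fin 3 → K} (hx : ∀ i, B i 2 = x i) {f : Fin 3 → MvPolynomial (Fin 2) K}
    {e : MvPolynomial (Fin 2) K} (he : ∀ i j, e ∣ C (x i) * f j - C (x j) * f i) {i : Fin 3}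
    (hi : i ≠ 2) : e ∣ changeParam B' f i := by
  have h1 : ∑ j, B' i j * x j = 0 := by
    simp only [← hx]
    rw [← Matrix.mul_apply, h', Matrix.one_apply_ne hi]
  have hx0 : ∃ k, x k ≠ 0 := by
    by_contra! h0
    have h2 := congrFun (congrFun h' 2) 2
    rw [Matrix.mul_apply] at h2
    simp [hx, h0] at h2
  obtain ⟨k, hk⟩ := hx0
  have hu : IsUnit (C (x k) : MvPolynomial (Fin 2) K) := (isUnit_iff_ne_zero.mpr hk).map C
  rw [← hu.dvd_mul_left]
  have h2 : C (x k) * changeParam B' f i =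
      ∑ j, C (B' i j) * (C (x k) * f j - C (x j) * f k) := by
    have h3 : C (∑ j, B' i j * x j) * f k = 0 := by rw [h1, map_zero, zero_mul]
    rw [map_sum, Finset.sum_mul] at h3
    rw [changeParam, Finset.mul_sum, ← sub_zero (∑ j, C (x k) * _), ← h3,
      ← Finset.sum_sub_distrib]
    refine Finset.sum_congr rfl fun j _ => ?_
    rw [map_mul]
    ring
  rw [h2]
  exact Finset.dvd_sum fun j _ => (he k j).mul_left _

theorem dvd_koszul_of_dvd_changeParam {B B' : Matrix (Fin 3) (Fin 3) K} (h : B * B' = 1)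
    {x : Fin 3 → K} (hx : ∀ i, B i 2 = x i) {f : Fin 3 → MvPolynomial (Fin 2) K}
    {e : MvPolynomial (Fin 2) K} (h0 : e ∣ changeParam B' f 0) (h1 : e ∣ changeParam B' f 1)
    (i j : Fin 3) : e ∣ C (x i) * f j - C (x j) * f i := by
  have h2 : ∀ i, f i = C (B i 0) * changeParam B' f 0 + C (B i 1) * changeParam B' f 1 +
      C (x i) * changeParam B' f 2 := fun i => by
    conv_lhs => rw [← changeParam_changeParam h f]
    rw [changeParam, Fin.sum_univ_three, hx]
  have h3 : C (x i) * f j - C (x j) * f i =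
      (C (x i) * C (B j 0) - C (x j) * C (B i 0)) * changeParam B' f 0 +
      (C (x i) * C (B j 1) - C (x j) * C (B i 1)) * changeParam B' f 1 := by
    rw [h2 i, h2 j]
    ring
  rw [h3]
  exact dvd_add (h0.mul_left _) (h1.mul_left _)

/-- The second new coordinate serves as denominator. If it vanishes, the first does not, and the two
are swapped. -/
theorem exists_matrix_changeParam_ne_zero {x : Fin 3 → K} (hx : x ≠ 0)
    {f : Fin 3 → MvPolynomial (Fin 2) K} (hne : ∃ i j, C (x i) * f j - C (x j) * f i ≠ 0) :
    ∃ B B' : Matrix (Fin 3) (Fin 3) K, B * B' = 1 ∧ B' * B = 1 ∧ (∀ i, B i 2 = x i) ∧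
      changeParam B' f 1 ≠ 0 := by
  obtain ⟨B, B', h, h', hB⟩ := exists_matrix_col_eq hx
  by_cases h1 : changeParam B' f 1 = 0
  · have h0 : changeParam B' f 0 ≠ 0 := by
      intro h0
      obtain ⟨i, j, hij⟩ := hne
      exact hij (zero_dvd_iff.mp
        (dvd_koszul_of_dvd_changeParam h hB (h0 ▸ dvd_rfl) (h1 ▸ dvd_rfl) i j))
    let τ : Equiv.Perm (Fin 3) := Equiv.swap 0 1
    refine ⟨B.submatrix id τ, B'.submatrix τ id, ?_, ?_, fun i => ?_, ?_⟩
    · rw [Matrix.submatrix_mul_equiv, h]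
      simp
    · rw [← Matrix.submatrix_mul _ _ _ _ _ Function.bijective_id, h']
      exact Matrix.submatrix_one_equiv τ
    · rw [Matrix.submatrix_apply, Equiv.swap_apply_of_ne_of_ne (by decide) (by decide)]
      exact hB i
    · have : changeParam (B'.submatrix τ id) f 1 = changeParam B' f 0 := by
        simp [changeParam, τ]
      rwa [this]
  · exact ⟨B, B', h, h', hB, h1⟩

end LinearChange

/-! ### The degree of `H` equals the multiplicity. -/

section Multiplicity

variable {K : Type*} [Field K]

/-- At a point `y` off the curve the gcd is trivial: modulo `e`, `0 = y k ^ D * F(f) ≡ f k ^ D *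
F(y)`, so `e` divides `f k ^ D` while being coprime to `f k`. -/
theorem isUnit_of_dvd_koszul_of_eval_ne_zero {n D : ℕ} {f : Fin 3 → MvPolynomial (Fin 2) K}
    (hf : IsProperParametrization n f) {F : MvPolynomial (Fin 3) K} (hF : F.IsHomogeneous D)
    (hFf : aeval f F = 0) {y : Fin 3 → K} (hy : y ≠ 0) (hFy : eval y F ≠ 0)
    {e : MvPolynomial (Fin 2) K} (he : ∀ i j, e ∣ C (y i) * f j - C (y j) * f i) : IsUnit e := by
  obtain ⟨k, hk⟩ := Function.ne_iff.mp hy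
  have h1 : (Ideal.Quotient.mkₐ K (Ideal.span {e})) (aeval (fun j => C (y k) * f j) F) =
      (Ideal.Quotient.mkₐ K (Ideal.span {e})) (aeval (fun j => f k * C (y j)) F) := by
    rw [← AlgHom.comp_apply, ← AlgHom.comp_apply, comp_aeval, comp_aeval]
    congr 2
    funext j
    rw [Ideal.Quotient.mkₐ_eq_mk, Ideal.Quotient.eq, Ideal.mem_span_singleton, mul_comm (f k)]
    exact he k j
  have h2 : aeval (fun j => (C (y j) : MvPolynomial (Fin 2) K)) F = C (eval y F) := by
    rw [← coe_aeval_eq_eval, ← algebraMap_eq]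
    exact (aeval_algebraMap_apply _ _ _)
  rw [aeval_mul_of_isHomogeneous hF, aeval_mul_of_isHomogeneous hF, hFf, mul_zero, map_zero, h2,
    eq_comm, Ideal.Quotient.mkₐ_eq_mk, Ideal.Quotient.eq_zero_iff_mem,
    Ideal.mem_span_singleton] at h1
  have hu : IsUnit (C (eval y F) : MvPolynomial (Fin 2) K) :=
    (isUnit_iff_ne_zero.mpr hFy).map C
  rw [hu.dvd_mul_right] at h1
  exact ((isRelPrime_of_dvd_koszul hf.gcd_eq_one hk he).pow_right (n := D)) dvd_rfl h1

variable [IsAlgClosed K]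

theorem orderAt_add_eq {n D : ℕ} (hn : 2 ≤ n) {f : Fin 3 → MvPolynomial (Fin 2) K}
    (hf : IsProperParametrization n f) {F : MvPolynomial (Fin 3) K} (hF : F.IsHomogeneous D)
    (hirr : Irreducible F) (hFf : aeval f F = 0) {x : Fin 3 → K} (hx : x ≠ 0)
    {G : MvPolynomial (Fin 2) K} (hG : ∀ i j, G ∣ C (x i) * f j - C (x j) * f i)
    (hG' : ∀ e, (∀ i j, e ∣ C (x i) * f j - C (x j) * f i) → e ∣ G) :
    orderAt F x + n = D + G.totalDegree := by
  obtain ⟨B, B', h, h', hB, h1⟩ := exists_matrix_changeParam_ne_zero hx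
    (exists_koszul_ne_zero (by omega) hf.homogeneous hf.gcd_eq_one hx)
  have hf' := isProperParametrization_changeParam h hf
  have hF' := isHomogeneous_linearSubst B hF
  have hirr' : Irreducible (linearSubst B F) :=
    (MulEquiv.irreducible_iff (linearSubstEquiv h h')).mpr hirr
  have hG1 : IsGCDOf {changeParam B' f 0, changeParam B' f 1} G := by
    refine ⟨?_, fun e he => hG' e fun i j => ?_⟩
    · rintro _ (rfl | rfl)
      · exact dvd_changeParam_of_dvd_koszul h' hB hG (by decide)
      · exact dvd_changeParam_of_dvd_koszul h' hB hG (by decide)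
    · exact dvd_koszul_of_dvd_changeParam h hB (he _ (Set.mem_insert _ _))
        (he _ (Set.mem_insert_of_mem _ rfl)) i j
  have e1 := degreeOf_add_totalDegree_gcd hn hf'.homogeneous hf'.gcd_eq_one hf'.birational h1 hG1
    hF' hirr' (by rw [aeval_linearSubst, changeParam_changeParam h, hFf])
  have e2 := orderAt_single_add_degreeOf hF' hirr'.ne_zero
  rw [orderAt_linearSubst h h', Matrix.mulVec_single_one] at e2
  have e3 : B.col 2 = x := funext hB
  rw [e3] at e2
  omega

theorem aeval_eq_zero_of_zeroLocus_eq {n D : ℕ} (hn : 0 < n) (hD : 0 < D)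
    {f : Fin 3 → MvPolynomial (Fin 2) K} (hf : ∀ i, (f i).IsHomogeneous n)
    {F : MvPolynomial (Fin 3) K} (hF : F.IsHomogeneous D) (hZ : zeroLocus F = curve f) :
    aeval f F = 0 := by
  have zero : ∀ {σ : Type} {P : MvPolynomial σ K} {d : ℕ}, P.IsHomogeneous d → 0 < d →
      eval (0 : σ → K) P = 0 := by
    intro σ P d hP hd
    have := aeval_mul_of_isHomogeneous hP (0 : K) (0 : σ → K)
    rw [zero_pow hd.ne', zero_mul] at this
    simpa [coe_aeval_eq_eval] using this
  refine MvPolynomial.funext fun x => ?_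
  have h1 : eval x (aeval f F) = eval (fun i => eval x (f i)) F := by
    rw [← coe_aeval_eq_eval, ← coe_aeval_eq_eval, RingHom.coe_coe, ← AlgHom.comp_apply, comp_aeval]
    rfl
  rw [h1, map_zero]
  by_cases h0 : (fun i => eval x (f i)) = 0
  · rw [h0]
    exact zero hF hD
  · have hx : x ≠ 0 := by
      rintro rfl
      have h2 : ∀ i, eval 0 (f i) = 0 := fun i => zero (hf i) hn
      exact h0 (by funext i; exact h2 i)
    have hmem : Projectivization.mk K _ h0 ∈ zeroLocus F := by
      rw [hZ]
      exact ⟨x, hx, h0, rfl⟩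
    rw [zeroLocus, Set.mem_ofPred_eq] at hmem
    obtain ⟨a, ha⟩ := Projectivization.exists_smul_eq_mk_rep K _ h0
    rw [← ha] at hmem
    have h2 := aeval_mul_of_isHomogeneous hF (a : K) (fun i => eval x (f i))
    rw [aeval_eq_eval, aeval_eq_eval] at h2
    change eval (fun i => (a : K) * eval x (f i)) F = 0 at hmem
    exact (mul_eq_zero.mp (h2.symm.trans hmem)).resolve_left (pow_ne_zero _ a.ne_zero)

theorem totalDegree_eq_multiplicity {n μ : ℕ} (hn : 2 ≤ n)
    {f p q : Fin 3 → MvPolynomial (Fin 2) K} (hf : IsProperParametrization n f)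
    (hpq : IsMuBasis n μ f p q) {Q : Projectivization K (Fin 3 → K)}
    (hQ : 1 < multiplicity (curve f) Q) {H : MvPolynomial (Fin 2) K} (hH : IsHPoly p q Q H) :
    H.totalDegree = multiplicity (curve f) Q := by
  -- The infimum of the empty set is `0`, so a multiplicity above `1` guarantees an irreducible
  -- equation.
  have hne : {m | ∃ (d : ℕ) (F : MvPolynomial (Fin 3) K), F.IsHomogeneous d ∧ Irreducible F ∧
      zeroLocus F = curve f ∧ orderAt F Q.rep = m}.Nonempty := by
    by_contra h
    rw [Set.not_nonempty_iff_eq_empty] at h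
    rw [multiplicity, h, Nat.sInf_empty] at hQ
    omega
  obtain ⟨D, F, hF, hirr, hZ, hord⟩ := Nat.sInf_mem hne
  change orderAt F Q.rep = multiplicity (curve f) Q at hord
  have hD : 0 < D := by
    rcases Nat.eq_zero_or_pos D with rfl | h
    · exact absurd (isUnit_of_isHomogeneous_zero hF hirr.ne_zero) hirr.not_isUnit
    · exact h
  have hFf := aeval_eq_zero_of_zeroLocus_eq (by omega) hD hf.homogeneous hF hZ
  obtain ⟨y, hy⟩ : ∃ y, eval y F ≠ 0 := by
    by_contra! h
    exact hirr.ne_zero (MvPolynomial.funext fun y => by rw [h y, map_zero])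
  have hy0 : y ≠ 0 := by
    rintro rfl
    have := aeval_mul_of_isHomogeneous hF (0 : K) (0 : Fin 3 → K)
    rw [zero_pow hD.ne', zero_mul] at this
    exact hy (by simpa [coe_aeval_eq_eval] using this)
  -- At a point off the curve both the order and the degree of the gcd are `0`, which gives `D = n`.
  have e1 := orderAt_add_eq hn hf hF hirr hFf hy0 (G := 1) (fun _ _ => one_dvd _) fun e he =>
    (isUnit_of_dvd_koszul_of_eval_ne_zero hf hF hFf hy0 hy he).dvd
  rw [orderAt_eq_zero hy, totalDegree_one] at e1
  have hsyz : ∀ g ∈ ({p, q} : Set (Fin 3 → MvPolynomial (Fin 2) K)), ∑ i, g i * f i = 0 := by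
    intro g hg
    have : g ∈ syzygies f := by
      rw [← hpq.span_eq]
      exact Submodule.subset_span hg
    exact this
  have e2 := orderAt_add_eq hn hf hF hirr hFf Q.rep_nonzero (G := H)
    (dvd_koszul hpq.span_eq (hH.1 _ (Set.mem_insert _ _)) (hH.1 _ (Set.mem_insert_of_mem _ rfl)))
    fun e he => hH.2 e (by
      rintro _ (rfl | rfl)
      · exact dvd_sum_of_dvd_koszul hf.gcd_eq_one Q.rep_nonzero he (hsyz p (Set.mem_insert _ _))
      · exact dvd_sum_of_dvd_koszul hf.gcd_eq_one Q.rep_nonzero he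
          (hsyz q (Set.mem_insert_of_mem _ rfl)))
  omega

end Multiplicity

end RationalCurve

end

theorem mainTheorem12 {K : Type*} [Field K] [IsAlgClosed K] [CharZero K]
    (n μ : ℕ) (hn : 3 ≤ n)
    (f p q : Fin 3 → MvPolynomial (Fin 2) K)
    (hf : RationalCurve.IsProperParametrization n f)
    (hpq : RationalCurve.IsMuBasis n μ f p q)
    (d : ℕ → MvPolynomial (Fin 2) K)
    (hd : RationalCurve.IsSingularFactors n μ f p q d)
    (Q : Projectivization K (Fin 3 → K))
    (hQ : RationalCurve.IsProperSingularPoint (RationalCurve.curve f) Q)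
    (H : MvPolynomial (Fin 2) K)
    (hH : RationalCurve.IsHPoly p q Q H) :
    H.totalDegree = RationalCurve.multiplicity (RationalCurve.curve f) Q ∧
    RationalCurve.multiplicity (RationalCurve.curve f) Q ≤ n ∧
    H ∣ d (RationalCurve.multiplicity (RationalCurve.curve f) Q) ∧
    ∀ k, RationalCurve.multiplicity (RationalCurve.curve f) Q < k → k ≤ n →
      IsRelPrime H (d k) := by
  have hm := RationalCurve.totalDegree_eq_multiplicity (by omega) hf hpq hQ.2 hH
  have hle := (RationalCurve.exists_isHPoly_eq_mul (by omega) hf hpq Q.rep_nonzero hH).2.2.1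
  have hpos : 0 < H.totalDegree := by
    have := hQ.2
    omega
  have hdvd := RationalCurve.dvd_singularFactor (by omega) hf hpq hd Q.rep_nonzero hH hpos
  rw [← hm]
  exact ⟨rfl, hle, hdvd⟩
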